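/- Let $\mathfrak g$ be a finite-dimensional complex Lie algebra with a symmetric invariant bilinear form $\langle\cdot,\cdot\rangle$, and let $\widehat{\mathfrak g}=\mathfrak g\otimes\mathbb C[t,t^{-1}]\oplus\mathbb C\mathbf k$ be the affine Lie algebra, with $\mathbf k$ central and $$[a\otimes t^m,b\otimes t^n]=[a,b]\otimes t^{m+n}+m\langle a,b\rangle\delta_{m+n,0}\mathbf k .$$ Put $\widehat{\mathfrak g}_\pm=\bigoplus_{\pm n>0}\mathfrak g\otimes t^n$ and $\widehat{\mathfrak g}_0=\mathfrak g\otimes t^0\oplus\mathbb C\mathbf k$. An integral form of a complex vector space is the $\mathbb Z$-span of a basis; an integral form of an associative algebra is a subring which is an integral form of the underlying vector space. Let $U_{\mathbb Z}(\widehat{\mathfrak g})$ be an integral form of the algebra $U(\widehat{\mathfrak g})$ such that $$U_{\mathbb Z}(\widehat{\mathfrak g})=U_{\mathbb Z}(\widehat{\mathfrak g}_-)\,U_{\mathbb Z}(\widehat{\mathfrak g}_0)\,U_{\mathbb Z}(\widehat{\mathfrak g}_+)$$ for integral forms $U_{\mathbb Z}(\widehat{\mathfrak g}_\pm)$, $U_{\mathbb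 Z}(\widehat{\mathfrak g}_0)$ of the algebras $U(\widehat{\mathfrak g}_\pm)$, $U(\widehat{\mathfrak g}_0)$, where moreover $U_{\mathbb Z}(\widehat{\mathfrak g}_\pm)=\bigoplus_{n\in\mathbb Z}U_{\mathbb Z}(\widehat{\mathfrak g}_\pm)\cap U(\widehat{\mathfrak g}_\pm)_n$; here $U(\widehat{\mathfrak g}_\pm)_n$ is the span of the monomials $(a_1\otimes t^{n_1})\cdots(a_k\otimes t^{n_k})$ with $n_1+\dots+n_k=n$. Let $\ell\in\mathbb Z$ and let $U$ be a finite-dimensional $\mathfrak g$-module, viewed as a $(\widehat{\mathfrak g}_+\oplus\widehat{\mathfrak g}_0)$-module on which $\widehat{\mathfrak g}_+$ acts as $0$ and $\mathbf k$ acts as $\ell$. Let $V_{\widehat{\mathfrak g}}(\ell,U)=U(\widehat{\mathfrak g})\otimes_{U(\widehat{\mathfrak g}_+\oplus\widehat{\mathfrak g}_0)}U$, with conformal weights counted from the lowest weight space: the space of weight $n$ is $U(\widehat{\mathfrak g}_-)_{-n}(1\otimes U)$. Let $L_{\widehat{\mathfrak g}}(\ell,U)$ be the quotient of $V_{\widehat{\mathfrak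 g}}(\ell,U)$, with the induced grading, by the sum of all graded submodules that intersect $1\otimes U$ trivially. Let $U_{\mathbb Z}$ be an integral form of the vector space $U$ that is invariant under $U_{\mathbb Z}(\widehat{\mathfrak g}_0)$, let $W$ be $V_{\widehat{\mathfrak g}}(\ell,U)$ or $L_{\widehat{\mathfrak g}}(\ell,U)$, and let $W_{\mathbb Z}=U_{\mathbb Z}(\widehat{\mathfrak g})U_{\mathbb Z}$ be the additive subgroup of $W$ generated by the products $x\cdot u$ with $x\in U_{\mathbb Z}(\widehat{\mathfrak g})$ and $u$ in the image of $U_{\mathbb Z}$ in $W$. Then $W_{\mathbb Z}$ is an integral form of the vector space $W$, it is invariant under $U_{\mathbb Z}(\widehat{\mathfrak g})$, and it is compatible with the conformal weight grading: $W_{\mathbb Z}=\bigoplus_n W_{\mathbb Z}\cap W_n$. Moreover, if $U$ is an irreducible $\mathfrak g$-module, then $L_{\widehat{\mathfrak g}}(\ell,U)$ is an irreducible $\widehat{\mathfrak g}$-module (the irreducible quotient of $V_{\widehat{\mathfrak g}}(\ell,U)$). -/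

import Mathlib

open scoped TensorProduct

universe u v

noncomputable section

namespace AffineForms

/-- An integral form of a complex vector space `V`: an additive subgroup which is the
`ℤ`-span of some `ℂ`-basis of `V`. -/
def IsIntegralForm {V : Type u} [AddCommGroup V] [Module ℂ V] (M : AddSubgroup V) : Prop :=
  ∃ (ι : Type u) (b : Module.Basis ι ℂ V), M = AddSubgroup.closure (Set.range b)

/-- `M = ∐ₙ M ∩ Vₙ`, as an internal direct sum of abelian groups. -/
def IsCompatible {V : Type u} [AddCommGroup V] [Module ℂ V] (M : AddSubgroup V)
    (grading : ℤ → Submodule ℂ V) : Prop :=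
  DirectSum.IsInternal fun n : ℤ => (grading n).toAddSubgroup.addSubgroupOf M

/-- A symmetric invariant bilinear form on the complex Lie algebra `g`
(invariance: `⟨[x, y], z⟩ = -⟨y, [x, z]⟩`; no non-degeneracy is required). -/
structure InvariantForm (g : Type u) [LieRing g] [LieAlgebra ℂ g] where
  /-- the underlying bilinear form -/
  form : LinearMap.BilinForm ℂ g
  invariant : form.lieInvariant g
  symmetric : form.IsSymm

section Affine

attribute [local instance 100] LieRing.ofAssociativeRing

variable {g : Type u} [LieRing g] [LieAlgebra ℂ g] (κ : InvariantForm g)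

/-- The 2-cocycle `(a ⊗ t^m, b ⊗ t^n) ↦ m ⟨a, b⟩ δ_{m+n,0}`. Mathlib's cocycle of a form `Φ` is
`n Φ(a, b) δ_{m+n,0} = -m Φ(a, b) δ_{m+n,0}`, whence the sign. -/
def cocycle : LieModule.Cohomology.twoCocycle ℂ (LieAlgebra.loopAlgebra ℂ ℤ g)
    (TrivialLieModule ℂ (LieAlgebra.loopAlgebra ℂ ℤ g) ℂ) :=
  LieAlgebra.LoopAlgebra.twoCocycleOfBilinear ℂ ℤ g (-κ.form)
    (fun x y z => by simp [κ.invariant x y z])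
    ⟨fun x y => by simpa using κ.symmetric.eq x y⟩

/-- The affine Lie algebra `ĝ = g ⊗ ℂ[t, t⁻¹] ⊕ ℂ k`. -/
abbrev Affine : Type u := LieAlgebra.ofTwoCocycle (cocycle κ)

/-- The element `a ⊗ t^n` of `ĝ`. -/
def mode (n : ℤ) (a : g) : Affine κ :=
  LieAlgebra.ofProd (cocycle κ) (AddMonoidAlgebra.single n 1 ⊗ₜ[ℂ] a, 0)

/-- The central element `k` of `ĝ`. -/
def central : Affine κ :=
  LieAlgebra.ofProd (cocycle κ) (0, (TrivialLieModule.equiv ℂ _ ℂ).symm 1)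

/-- The linear map `ĝ → g` taking the coefficient of `t^n`. -/
def coeff (n : ℤ) : Affine κ →ₗ[ℂ] g where
  toFun x := LieAlgebra.LoopAlgebra.toFinsupp ℂ ℤ g ((LieAlgebra.ofProd (cocycle κ)).symm x).1 n
  map_add' x y := by simp
  map_smul' r x := by simp

/-- The linear map `ĝ → ℂ` taking the coefficient of `k`. -/
def centralCoeff : Affine κ →ₗ[ℂ] ℂ where
  toFun x := TrivialLieModule.equiv ℂ _ ℂ ((LieAlgebra.ofProd (cocycle κ)).symm x).2
  map_add' x y := by simp
  map_smul' r x := by simp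

@[simp] lemma coeff_mode (m n : ℤ) (a : g) :
    coeff κ m (mode κ n a) = if n = m then a else 0 := by
  change (LieAlgebra.LoopAlgebra.toFinsupp ℂ ℤ g (AddMonoidAlgebra.single n 1 ⊗ₜ[ℂ] a)) m = _
  rw [LieAlgebra.LoopAlgebra.toFinsupp_single_tmul, Finsupp.single_apply]

@[simp] lemma coeff_central (m : ℤ) : coeff κ m (central κ) = 0 := by
  simp [coeff, central]

@[simp] lemma centralCoeff_mode (n : ℤ) (a : g) : centralCoeff κ (mode κ n a) = 0 := by
  simp [centralCoeff, mode]

@[simp] lemma centralCoeff_central : centralCoeff κ (central κ) = 1 := by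
  simp [centralCoeff, central]

/-- `[a ⊗ t^m, b ⊗ t^n] = [a, b] ⊗ t^(m+n) + m ⟨a, b⟩ δ_{m+n,0} k`. -/
lemma lie_mode_mode (m n : ℤ) (a b : g) :
    ⁅mode κ m a, mode κ n b⁆ =
      mode κ (m + n) ⁅a, b⁆ + (if m + n = 0 then (m : ℂ) * κ.form a b else 0) • central κ := by
  have h2 : LieAlgebra.LoopAlgebra.residuePairing ℂ ℤ g (-κ.form)
      (AddMonoidAlgebra.single m 1 ⊗ₜ[ℂ] a) (AddMonoidAlgebra.single n 1 ⊗ₜ[ℂ] b) =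
      if m + n = 0 then (m : ℂ) * κ.form a b else 0 := by
    rw [LieAlgebra.LoopAlgebra.residuePairing_apply_apply,
      LieAlgebra.LoopAlgebra.toFinsupp_single_tmul, LieAlgebra.LoopAlgebra.toFinsupp_single_tmul,
      Finsupp.sum_single_index (by simp), Finsupp.single_apply]
    split_ifs with h h' h'
    · subst h; simp
    · omega
    · omega
    · simp
  rw [LieAlgebra.bracket_ofTwoCocycle]
  simp only [mode, central]
  rw [← LieAlgebra.of_smul, ← LieAlgebra.of_add]
  congr 1
  refine Prod.ext ?_ ?_
  · change ⁅(AddMonoidAlgebra.single m 1 ⊗ₜ[ℂ] a : LieAlgebra.loopAlgebra ℂ ℤ g),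
      (AddMonoidAlgebra.single n 1 ⊗ₜ[ℂ] b : LieAlgebra.loopAlgebra ℂ ℤ g)⁆ =
      AddMonoidAlgebra.single (m + n) 1 ⊗ₜ[ℂ] ⁅a, b⁆ + _ • 0
    rw [LieAlgebra.ExtendScalars.bracket_tmul, AddMonoidAlgebra.single_mul_single, one_mul,
      smul_zero, add_zero]
  · rw [← h2]
    simp only [Equiv.symm_apply_apply, lie_zero, add_zero, sub_zero, Prod.snd_add, Prod.smul_snd,
      zero_add]
    change (LieAlgebra.LoopAlgebra.residuePairing ℂ ℤ g (-κ.form)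
      (AddMonoidAlgebra.single m 1 ⊗ₜ[ℂ] a) (AddMonoidAlgebra.single n 1 ⊗ₜ[ℂ] b)) = _ • (1 : ℂ)
    exact (mul_one _).symm

lemma lie_central (x : Affine κ) : ⁅x, central κ⁆ = 0 := by
  rw [LieAlgebra.bracket_ofTwoCocycle, ← LieAlgebra.of_zero]
  congr 1
  refine Prod.ext ?_ ?_ <;> simp [central, trivial_lie_zero]

lemma central_lie (x : Affine κ) : ⁅central κ, x⁆ = 0 := by
  rw [← lie_skew, lie_central, neg_zero]

/-- The Lie subalgebra spanned by a set whose linear span is closed under brackets. -/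
def spanSubalgebra (s : Set (Affine κ))
    (h : ∀ x ∈ s, ∀ y ∈ s, ⁅x, y⁆ ∈ Submodule.span ℂ s) : LieSubalgebra ℂ (Affine κ) where
  __ := Submodule.span ℂ s
  lie_mem' {x y} hx hy := by
    change ⁅x, y⁆ ∈ Submodule.span ℂ s
    induction hx, hy using Submodule.span_induction₂ with
    | mem_mem x y hx hy => exact h x hx y hy
    | zero_left => simp
    | zero_right => simp
    | add_left x y z _ _ _ h1 h2 => rw [add_lie]; exact add_mem h1 h2
    | add_right x y z _ _ _ h1 h2 => rw [lie_add]; exact add_mem h1 h2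
    | smul_left r x y _ _ h => rw [smul_lie]; exact Submodule.smul_mem _ _ h
    | smul_right r x y _ _ h => rw [lie_smul]; exact Submodule.smul_mem _ _ h

/-- `ĝ₋`, the span of the `a ⊗ t^n` with `n < 0`. -/
def minusPart : LieSubalgebra ℂ (Affine κ) :=
  spanSubalgebra κ {x | ∃ n < (0 : ℤ), ∃ a : g, x = mode κ n a} (by
    rintro _ ⟨m, hm, a, rfl⟩ _ ⟨n, hn, b, rfl⟩
    rw [lie_mode_mode, if_neg (by omega), zero_smul, add_zero]
    exact Submodule.subset_span ⟨m + n, by omega, _, rfl⟩)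

/-- `ĝ₊`, the span of the `a ⊗ t^n` with `n > 0`. -/
def plusPart : LieSubalgebra ℂ (Affine κ) :=
  spanSubalgebra κ {x | ∃ n > (0 : ℤ), ∃ a : g, x = mode κ n a} (by
    rintro _ ⟨m, hm, a, rfl⟩ _ ⟨n, hn, b, rfl⟩
    rw [lie_mode_mode, if_neg (by omega), zero_smul, add_zero]
    exact Submodule.subset_span ⟨m + n, by omega, _, rfl⟩)

/-- `ĝ₀ = g ⊗ t⁰ ⊕ ℂ k`. -/
def zeroPart : LieSubalgebra ℂ (Affine κ) :=
  spanSubalgebra κ {x | (∃ a : g, x = mode κ 0 a) ∨ x = central κ} (by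
    rintro _ (⟨a, rfl⟩ | rfl) _ (⟨b, rfl⟩ | rfl)
    · rw [lie_mode_mode]
      simp only [add_zero, Int.cast_zero, zero_mul, ite_self, zero_smul]
      exact Submodule.subset_span (Or.inl ⟨_, rfl⟩)
    · simp [lie_central]
    · simp [central_lie]
    · simp)

/-- `ĝ₊ ⊕ ĝ₀`, the span of `k` and of the `a ⊗ t^n` with `n ≥ 0`. -/
def nonnegPart : LieSubalgebra ℂ (Affine κ) :=
  spanSubalgebra κ {x | (∃ n ≥ (0 : ℤ), ∃ a : g, x = mode κ n a) ∨ x = central κ} (by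
    rintro _ (⟨m, hm, a, rfl⟩ | rfl) _ (⟨n, hn, b, rfl⟩ | rfl)
    · rw [lie_mode_mode]
      exact add_mem (Submodule.subset_span (Or.inl ⟨m + n, by omega, _, rfl⟩))
        (Submodule.smul_mem _ _ (Submodule.subset_span (Or.inr rfl)))
    · simp [lie_central]
    · simp [central_lie]
    · simp)

lemma zeroPart_le_nonnegPart : zeroPart κ ≤ nonnegPart κ := by
  change Submodule.span ℂ _ ≤ Submodule.span ℂ _
  refine Submodule.span_mono ?_
  rintro _ (⟨a, rfl⟩ | rfl)
  · exact Or.inl ⟨0, le_refl _, a, rfl⟩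
  · exact Or.inr rfl

lemma coeff_zero_lie {x y : Affine κ} (hx : x ∈ nonnegPart κ) (hy : y ∈ nonnegPart κ) :
    coeff κ 0 ⁅x, y⁆ = ⁅coeff κ 0 x, coeff κ 0 y⁆ := by
  change x ∈ Submodule.span ℂ _ at hx
  change y ∈ Submodule.span ℂ _ at hy
  induction hx, hy using Submodule.span_induction₂ with
  | mem_mem x y hx hy =>
    obtain (⟨m, hm, a, rfl⟩ | rfl) := hx <;> obtain (⟨n, hn, b, rfl⟩ | rfl) := hy
    · rw [lie_mode_mode]
      simp only [map_add, map_smul, coeff_central, coeff_mode, smul_zero, add_zero]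
      split_ifs <;> first | omega | simp
    · simp [lie_central]
    · simp [central_lie]
    · simp
  | zero_left => simp
  | zero_right => simp
  | add_left x y z _ _ _ h1 h2 => simp [h1, h2]
  | add_right x y z _ _ _ h1 h2 => simp [h1, h2]
  | smul_left r x y _ _ h => simp [h]
  | smul_right r x y _ _ h => simp [h]

lemma centralCoeff_lie {x y : Affine κ} (hx : x ∈ nonnegPart κ) (hy : y ∈ nonnegPart κ) :
    centralCoeff κ ⁅x, y⁆ = 0 := by
  change x ∈ Submodule.span ℂ _ at hx
  change y ∈ Submodule.span ℂ _ at hy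
  induction hx, hy using Submodule.span_induction₂ with
  | mem_mem x y hx hy =>
    obtain (⟨m, hm, a, rfl⟩ | rfl) := hx <;> obtain (⟨n, hn, b, rfl⟩ | rfl) := hy
    · rw [lie_mode_mode]
      simp only [map_add, map_smul, centralCoeff_central, centralCoeff_mode, zero_add,
        smul_eq_mul, mul_one]
      split_ifs with h
      · obtain rfl : m = 0 := by omega
        simp
      · rfl
    · simp [lie_central]
    · simp [central_lie]
    · simp
  | zero_left => simp
  | zero_right => simp
  | add_left x y z _ _ _ h1 h2 => simp [h1, h2]
  | add_right x y z _ _ _ h1 h2 => simp [h1, h2]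
  | smul_left r x y _ _ h => simp [h]
  | smul_right r x y _ _ h => simp [h]

/-- `U(ĝ)` -/
abbrev Env : Type u := UniversalEnvelopingAlgebra ℂ (Affine κ)

/-- The canonical algebra map `U(K) → U(ĝ)` for a Lie subalgebra `K` of `ĝ`. -/
def envMap (K : LieSubalgebra ℂ (Affine κ)) : UniversalEnvelopingAlgebra ℂ K →ₐ[ℂ] Env κ :=
  UniversalEnvelopingAlgebra.lift ℂ ((UniversalEnvelopingAlgebra.ι ℂ).comp K.incl)

/-- `U(K)_n`: the span in `U(K)` of the monomials `(a₁ ⊗ t^{n₁}) ⋯ (a_k ⊗ t^{n_k})` whose factors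
lie in `K` and for which `n₁ + ⋯ + n_k = n`. -/
def envDegree (K : LieSubalgebra ℂ (Affine κ)) (n : ℤ) :
    Submodule ℂ (UniversalEnvelopingAlgebra ℂ K) :=
  Submodule.span ℂ {x | ∃ l : List (ℤ × K), (∀ p ∈ l, ∃ a : g, (p.2 : Affine κ) = mode κ p.1 a) ∧
    (l.map Prod.fst).sum = n ∧ x = (l.map fun p => UniversalEnvelopingAlgebra.ι ℂ p.2).prod}

/-- An integral form `U_ℤ(ĝ)` of the associative algebra `U(ĝ)` (a subring which is an integral
form of the vector space), of the form `U_ℤ(ĝ₋) U_ℤ(ĝ₀) U_ℤ(ĝ₊)` for integral forms of the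
algebras `U(ĝ₋)`, `U(ĝ₀)`, `U(ĝ₊)`, those of `U(ĝ₋)` and `U(ĝ₊)` being graded. -/
structure IntegralEnvelope where
  /-- `U_ℤ(ĝ)` -/
  whole : Subring (Env κ)
  /-- `U_ℤ(ĝ₋)` -/
  minus : Subring (UniversalEnvelopingAlgebra ℂ (minusPart κ))
  /-- `U_ℤ(ĝ₀)` -/
  zero : Subring (UniversalEnvelopingAlgebra ℂ (zeroPart κ))
  /-- `U_ℤ(ĝ₊)` -/
  plus : Subring (UniversalEnvelopingAlgebra ℂ (plusPart κ))
  whole_form : IsIntegralForm whole.toAddSubgroup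
  minus_form : IsIntegralForm minus.toAddSubgroup
  zero_form : IsIntegralForm zero.toAddSubgroup
  plus_form : IsIntegralForm plus.toAddSubgroup
  decomposition : whole.toAddSubgroup = AddSubgroup.closure
    {x | ∃ a ∈ minus, ∃ b ∈ zero, ∃ c ∈ plus,
      x = envMap κ (minusPart κ) a * envMap κ (zeroPart κ) b * envMap κ (plusPart κ) c}
  minus_graded : IsCompatible minus.toAddSubgroup (envDegree κ (minusPart κ))
  plus_graded : IsCompatible plus.toAddSubgroup (envDegree κ (plusPart κ))

/-- `W_ℤ = U_ℤ(ĝ) T`, the additive subgroup generated by the products `x • t`. -/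
def generated {κ : InvariantForm g} (A : Subring (Env κ)) {W : Type v} [AddCommGroup W]
    [Module (Env κ) W] (T : Set W) : AddSubgroup W :=
  AddSubgroup.closure {w | ∃ x ∈ A, ∃ t ∈ T, w = x • t}

section Modules

variable (ℓ : ℤ) (U : Type v) [AddCommGroup U] [Module ℂ U] [LieRingModule g U] [LieModule ℂ g U]

/-- The action of `ĝ₊ ⊕ ĝ₀` on the `g`-module `U`: `a ⊗ t^n` acts as `0` for `n > 0` and as `a` for
`n = 0`, and `k` acts as `ℓ`. -/
def nonnegAction : nonnegPart κ →ₗ⁅ℂ⁆ Module.End ℂ U where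
  toFun x := LieModule.toEnd ℂ g U (coeff κ 0 x) +
    ((ℓ : ℂ) * centralCoeff κ x) • (1 : Module.End ℂ U)
  map_add' x y := by
    simp [mul_add, add_smul]
    abel
  map_smul' r x := by
    simp [smul_smul, mul_left_comm]
  map_lie' {x y} := by
    rw [LieSubalgebra.coe_bracket, coeff_zero_lie κ x.2 y.2, centralCoeff_lie κ x.2 y.2]
    ext u
    simp [LieRing.of_associative_ring_bracket]
    module

/-- The action of `U(ĝ₊ ⊕ ĝ₀)` on `U`. -/
def nonnegEnvAction : UniversalEnvelopingAlgebra ℂ (nonnegPart κ) →ₐ[ℂ] Module.End ℂ U :=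
  UniversalEnvelopingAlgebra.lift ℂ (nonnegAction κ ℓ U)

/-- The action of `U(ĝ₀)` on `U`, for which `k` acts as `ℓ`. -/
def zeroEnvAction : UniversalEnvelopingAlgebra ℂ (zeroPart κ) →ₐ[ℂ] Module.End ℂ U :=
  UniversalEnvelopingAlgebra.lift ℂ
    ((nonnegAction κ ℓ U).comp (LieSubalgebra.inclusion (zeroPart_le_nonnegPart κ)))

/-- The left `U(ĝ)`-submodule of `U(ĝ) ⊗_ℂ U` generated by the `b ⊗ u - 1 ⊗ b u` with
`b ∈ U(ĝ₊ ⊕ ĝ₀)`; equivalently, the span of the `x b ⊗ u - x ⊗ b u` with `x ∈ U(ĝ)`. -/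
def vermaRelations : Submodule (Env κ) (Env κ ⊗[ℂ] U) :=
  Submodule.span (Env κ) {z | ∃ (b : UniversalEnvelopingAlgebra ℂ (nonnegPart κ)) (u : U),
    z = envMap κ (nonnegPart κ) b ⊗ₜ[ℂ] u - 1 ⊗ₜ[ℂ] nonnegEnvAction κ ℓ U b u}

/-- The generalized Verma module `V_ĝ(ℓ, U) = U(ĝ) ⊗_{U(ĝ₊ ⊕ ĝ₀)} U`. -/
abbrev Verma : Type (max u v) := (Env κ ⊗[ℂ] U) ⧸ vermaRelations κ ℓ U

/-- The map `U → V_ĝ(ℓ, U)`, `u ↦ 1 ⊗ u`. -/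
def vermaTop : U →ₗ[ℂ] Verma κ ℓ U :=
  ((vermaRelations κ ℓ U).mkQ.restrictScalars ℂ) ∘ₗ TensorProduct.mk ℂ (Env κ) U 1

/-- The weight grading of `V_ĝ(ℓ, U)`, where the weight is counted from the lowest weight space:
the `n`-th space is `U(ĝ₋)_{-n} (1 ⊗ U)`. -/
def vermaGrading (n : ℤ) : Submodule ℂ (Verma κ ℓ U) :=
  Submodule.span ℂ {w | ∃ x ∈ envDegree κ (minusPart κ) (-n), ∃ u : U,
    w = envMap κ (minusPart κ) x • vermaTop κ ℓ U u}

/-- A `ĝ`-submodule `N` of `V_ĝ(ℓ, U)` is graded if it is the sum of its intersections with the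
weight spaces. -/
def IsGradedSubmodule (N : Submodule (Env κ) (Verma κ ℓ U)) : Prop :=
  N.restrictScalars ℂ = ⨆ n : ℤ, N.restrictScalars ℂ ⊓ vermaGrading κ ℓ U n

/-- The sum of all graded submodules of `V_ĝ(ℓ, U)` which meet `1 ⊗ U` only in `0`. If the
`g`-module `U` is irreducible, these are all proper graded submodules, so that this is the
maximal one. -/
def vermaMaximal : Submodule (Env κ) (Verma κ ℓ U) :=
  sSup {N | IsGradedSubmodule κ ℓ U N ∧ ∀ u : U, vermaTop κ ℓ U u ∈ N → vermaTop κ ℓ U u = 0}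

/-- `L_ĝ(ℓ, U)`, for irreducible `U` the irreducible quotient of `V_ĝ(ℓ, U)`. -/
abbrev Irr : Type (max u v) := Verma κ ℓ U ⧸ vermaMaximal κ ℓ U

/-- The map `U → L_ĝ(ℓ, U)` induced by `u ↦ 1 ⊗ u`. -/
def irrTop : U →ₗ[ℂ] Irr κ ℓ U :=
  ((vermaMaximal κ ℓ U).mkQ.restrictScalars ℂ) ∘ₗ vermaTop κ ℓ U

/-- The weight grading of `L_ĝ(ℓ, U)`, the image of that of `V_ĝ(ℓ, U)`. -/
def irrGrading (n : ℤ) : Submodule ℂ (Irr κ ℓ U) :=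
  (vermaGrading κ ℓ U n).map ((vermaMaximal κ ℓ U).mkQ.restrictScalars ℂ)

end Modules

end Affine

end AffineForms

end

/-! The main tool is `HasScalarLifts`. If `M` is spanned over `ℤ` by a complex basis, any `ℚ`-linear
`f : ℂ → ℚ` can be applied coordinatewise, giving an additive `F` with `F (c • m) = f c • m` on `M`.
Conversely, such maps turn a complex relation among elements of `M` into rational ones, so
`ℤ`-independent elements of `M` are `ℂ`-independent. If in addition `M` is a sum of finitely
generated pieces lying in independent graded spaces, each piece is free on a `ℂ`-independent family,
and together these families form a basis (`HasScalarLifts.isIntegralForm_of_iSup`).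

For the Verma module, the triangular decomposition reduces `U_ℤ(ĝ) U_ℤ` to `U_ℤ(ĝ₋) U_ℤ`
(`generated_eq_iSup`). The delicate point is that `U_ℤ(ĝ₊)` acts on `1 ⊗ U` through its
augmentation, which must take integer values: a scalar in a subring that is an integral form has
powers with bounded denominators, hence is an integer. An explicit action of `ĝ` on `U(ĝ₋) ⊗ U`
identifies this space with the Verma module (`tensorToVerma_bijective`), so a product basis supplies
scalar lifts. The weight spaces are eigenspaces of the operator induced by `a ⊗ t^n ↦ 2^n a ⊗ t^n`,
and they meet the integral form in finitely generated groups.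

For the quotient, the maximal submodule is the set of `v` such that `U(ĝ) v` has no component of
weight `0` (`vermaMaximal_eq_residual`). The maps `F` commute with `U_ℤ(ĝ)` and respect weights, so
they preserve this submodule and descend (`hasScalarLifts_generated_irr`). The same description
gives irreducibility: a strictly larger submodule, graded or not, contains a nonzero vector of `1 ⊗
U` (`exists_vermaTop_mem`). -/

noncomputable section

namespace AffineForms

/-! ### Integral forms and scalar lifts -/

section IntegralForms

variable {V : Type v} [AddCommGroup V] [Module ℂ V]

/-- Every `ℚ`-linear map `ℂ → ℚ` extends to an additive endomorphism of `V` which treats the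
elements of `M` as constants. -/
def HasScalarLifts (M : AddSubgroup V) : Prop :=
  ∀ f : ℂ →ₗ[ℚ] ℚ, ∃ F : V →+ V, ∀ c : ℂ, ∀ m ∈ M, F (c • m) = (f c : ℂ) • m

/-- Elements of the group have integer coordinates, and `f (k * c) = k * f c` for integers `k`, so
`f` may be applied to each coordinate. -/
lemma hasScalarLifts_closure_range {ι : Type*} (b : Module.Basis ι ℂ V) :
    HasScalarLifts (AddSubgroup.closure (Set.range b)) := by
  intro f
  let φ : ℂ →+ ℂ := (algebraMap ℚ ℂ : ℚ →+ ℂ).comp f.toAddMonoidHom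
  refine ⟨(b.repr.symm : (ι →₀ ℂ) →+ V).comp
    ((Finsupp.mapRange.addMonoidHom φ).comp (b.repr : V →+ (ι →₀ ℂ))), fun c m hm => ?_⟩
  induction hm using AddSubgroup.closure_induction with
  | mem x hx =>
    obtain ⟨i, rfl⟩ := hx
    simp [φ, Finsupp.mapRange_single]
  | zero => simp
  | add x y _ _ hx hy => rw [smul_add, map_add, hx, hy, smul_add]
  | neg x _ hx => rw [smul_neg, map_neg, hx, smul_neg]

lemma IsIntegralForm.span_eq_top {M : AddSubgroup V} (hM : IsIntegralForm M) :
    Submodule.span ℂ (M : Set V) = ⊤ := by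
  obtain ⟨ι, b, rfl⟩ := hM
  rw [eq_top_iff, ← b.span_eq]
  exact Submodule.span_mono AddSubgroup.subset_closure

/-- Applying `F` to a complex relation with coefficients `c i` gives a rational relation with
coefficients `f (c i)`. These vanish because `ℤ`-independence implies `ℚ`-independence, and the
functionals `f` separate the points of `ℂ`. -/
lemma HasScalarLifts.linearIndependent {M : AddSubgroup V} (hM : HasScalarLifts M) {ι : Type*}
    {w : ι → V} (hw : ∀ i, w i ∈ M) (hind : LinearIndependent ℤ w) : LinearIndependent ℂ w := by
  let : Module ℚ V := Module.compHom V (algebraMap ℚ ℂ)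
  have hQ : LinearIndependent ℚ w := (LinearIndependent.iff_fractionRing ℤ ℚ).1 hind
  rw [linearIndependent_iff'] at hQ ⊢
  intro s c hc i hi
  rw [← Module.forall_dual_apply_eq_zero_iff ℚ]
  intro f
  obtain ⟨F, hF⟩ := hM f
  refine hQ s (fun i => f (c i)) ?_ i hi
  have h := congrArg F hc
  rw [map_sum, map_zero] at h
  rw [← h]
  refine Finset.sum_congr rfl fun i _ => ?_
  rw [hF _ _ (hw i)]
  rfl

/-- A finitely generated torsion-free abelian group is free, and scalar lifts promote a `ℤ`-basis to
a `ℂ`-independent family. -/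
lemma HasScalarLifts.exists_linearIndependent {M : AddSubgroup V} (hM : HasScalarLifts M)
    (hfg : M.FG) : ∃ (k : ℕ) (w : Fin k → V), LinearIndependent ℂ w ∧
      M = AddSubgroup.closure (Set.range w) := by
  let N : Submodule ℤ V := AddSubgroup.toIntSubmodule M
  have : Module.Finite ℤ N := by
    rw [Module.Finite.iff_fg, Submodule.fg_iff_addSubgroup_fg]
    exact hfg
  have : Module.IsTorsionFree ℤ V := Module.IsTorsionFree.trans_faithfulSMul ℤ ℂ V
  let b := Module.finBasis ℤ N
  refine ⟨_, fun i => (b i : V), hM.linearIndependent (fun i => (b i).2)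
    (b.linearIndependent.map' N.subtype (Submodule.ker_subtype N)), ?_⟩
  have h1 : Submodule.span ℤ (Set.range fun i => (b i : V)) = N := by
    have := congrArg (Submodule.map N.subtype) b.span_eq
    rw [Submodule.map_span, Submodule.map_top, Submodule.range_subtype, ← Set.range_comp] at this
    exact this
  have h2 := congrArg Submodule.toAddSubgroup h1
  rw [Submodule.span_int_eq_addSubgroupClosure] at h2
  simpa [N] using h2.symm

lemma isIntegralForm_of_basis {ι : Type*} (b : Module.Basis ι ℂ V) :
    IsIntegralForm (AddSubgroup.closure (Set.range b)) :=
  ⟨Set.range b, b.reindexRange, by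
    congr 1
    ext x
    simp⟩

lemma isCompatible_of_iSup {M : AddSubgroup V} {W : ℤ → Submodule ℂ V} {N : ℤ → AddSubgroup V}
    (hind : iSupIndep W) (hN : ∀ n, N n ≤ (W n).toAddSubgroup) (hM : M = ⨆ n, N n) :
    IsCompatible M W := by
  classical
  have hNM : ∀ n, N n ≤ M := fun n => hM ▸ le_iSup N n
  constructor
  · let F : (DirectSum ℤ fun n => (W n).toAddSubgroup.addSubgroupOf M) →+
        DirectSum ℤ fun n => W n :=
      DirectSum.map fun n =>
        { toFun := fun x => ⟨((x : M) : V), x.2⟩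
          map_zero' := rfl
          map_add' := fun _ _ => rfl }
    have hF : Function.Injective F := by
      refine DirectSum.map_injective _ |>.2 fun n x y h => ?_
      exact Subtype.ext (Subtype.ext (congrArg (fun z : W n => (z : V)) h))
    have hcomp : (DirectSum.coeAddMonoidHom W).comp F =
        M.subtype.comp (DirectSum.coeAddMonoidHom
          fun n => (W n).toAddSubgroup.addSubgroupOf M) := by
      refine DirectSum.addHom_ext fun n x => ?_
      simp [F, DirectSum.map_of]
    have hinj : Function.Injective (DirectSum.coeAddMonoidHom W) :=
      hind.dfinsupp_lsum_injective
    intro x y hxy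
    apply hF
    apply hinj
    have := congrArg Subtype.val hxy
    exact (DFunLike.congr_fun hcomp x).trans (this.trans (DFunLike.congr_fun hcomp y).symm)
  · rintro ⟨m, hm⟩
    change (⟨m, hm⟩ : M) ∈ (DirectSum.coeAddMonoidHom
          fun n => (W n).toAddSubgroup.addSubgroupOf M).range
    set R := (DirectSum.coeAddMonoidHom
          fun n => (W n).toAddSubgroup.addSubgroupOf M).range
    have : M ≤ R.map M.subtype := by
      conv_lhs => rw [hM]
      refine iSup_le fun n x hx => ?_
      refine ⟨⟨x, hNM n hx⟩, ⟨DirectSum.of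
        (fun n => (W n).toAddSubgroup.addSubgroupOf M) n ⟨⟨x, hNM n hx⟩, hN n hx⟩, ?_⟩, rfl⟩
      simp
    obtain ⟨y, hy, hym⟩ := this hm
    rwa [show (⟨m, hm⟩ : M) = y from Subtype.ext hym.symm]

/-- Scalar lifts restrict to each `N n`, whose `ℤ`-basis is therefore a complex basis of `W n`;
these bases are collected along the direct sum. -/
lemma HasScalarLifts.isIntegralForm_of_iSup {M : AddSubgroup V} (hM : HasScalarLifts M)
    {W : ℤ → Submodule ℂ V} {N : ℤ → AddSubgroup V} (hind : iSupIndep W) (htop : ⨆ n, W n = ⊤)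
    (hspan : ∀ n, Submodule.span ℂ (N n : Set V) = W n) (hfg : ∀ n, (N n).FG)
    (hN : M = ⨆ n, N n) : IsIntegralForm M := by
  classical
  have hQ : ∀ n, HasScalarLifts (N n) := fun n f => by
    obtain ⟨F, hF⟩ := hM f
    exact ⟨F, fun c m hm => hF c m (hN ▸ le_iSup N n hm)⟩
  choose k w hw hNw using fun n => (hQ n).exists_linearIndependent (hfg n)
  have hspan' : ∀ n, Submodule.span ℂ (Set.range (w n)) = W n := fun n => by
    rw [← hspan n]
    refine le_antisymm (Submodule.span_mono ?_) (Submodule.span_le.2 ?_)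
    · rw [hNw n]; exact AddSubgroup.subset_closure
    · intro x hx
      have : (N n) ≤ (Submodule.span ℂ (Set.range (w n))).toAddSubgroup := by
        conv_lhs => rw [hNw n]
        rw [AddSubgroup.closure_le]
        exact Submodule.subset_span
      exact this hx
  let B : ∀ n, Module.Basis (Fin (k n)) ℂ (W n) := fun n =>
    (Module.Basis.span (hw n)).map (LinearEquiv.ofEq _ _ (hspan' n))
  have hB : ∀ n i, (B n i : V) = w n i := fun n i => by
    simp [B, Module.Basis.span_apply]
  have hint := DirectSum.isInternal_submodule_of_iSupIndep_of_iSup_eq_top hind htop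
  have : M = AddSubgroup.closure (Set.range (hint.collectedBasis B)) := by
    rw [hN, DirectSum.IsInternal.collectedBasis_coe]
    simp only [hB]
    rw [Set.range_sigma_eq_iUnion_range, AddSubgroup.closure_iUnion]
    exact iSup_congr hNw
  rw [this]
  exact isIntegralForm_of_basis _

lemma exists_int_repr {ι : Type*} (b : Module.Basis ι ℂ V) {m : V}
    (hm : m ∈ AddSubgroup.closure (Set.range b)) (i : ι) : ∃ k : ℤ, b.repr m i = k := by
  induction hm using AddSubgroup.closure_induction with
  | mem x hx =>
    obtain ⟨j, rfl⟩ := hx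
    classical
    rw [b.repr_self, Finsupp.single_apply]
    split_ifs
    · exact ⟨1, by simp⟩
    · exact ⟨0, by simp⟩
  | zero => exact ⟨0, by simp⟩
  | add x y _ _ hx hy =>
    obtain ⟨k, hk⟩ := hx
    obtain ⟨l, hl⟩ := hy
    exact ⟨k + l, by simp [hk, hl]⟩
  | neg x _ hx =>
    obtain ⟨k, hk⟩ := hx
    exact ⟨-k, by simp [hk]⟩

lemma fg_of_le {V : Type*} [AddCommGroup V] {M N : AddSubgroup V} (h : M ≤ N) (hN : N.FG) :
    M.FG := by
  rw [← AddSubgroup.toIntSubmodule.symm_apply_apply M]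
  rw [← AddSubgroup.toIntSubmodule.symm_apply_apply N] at hN
  have hN' : (AddSubgroup.toIntSubmodule N).FG := (Submodule.fg_iff_addSubgroup_fg _).2 hN
  have : IsNoetherian ℤ (AddSubgroup.toIntSubmodule N) := isNoetherian_of_fg_of_noetherian _ hN'
  have : IsNoetherian ℤ (AddSubgroup.toIntSubmodule M) :=
    isNoetherian_of_le (t := AddSubgroup.toIntSubmodule N) h
  exact (Submodule.fg_iff_addSubgroup_fg _).1 (isNoetherian_submodule.1 this _ le_rfl)

/-- A finite-dimensional subspace involves only finitely many basis vectors, and elements of `M`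
have integer coordinates on them. -/
lemma IsIntegralForm.fg_inf {M : AddSubgroup V} (hM : IsIntegralForm M) {F : Submodule ℂ V}
    (hF : F.FG) : (M ⊓ F.toAddSubgroup).FG := by
  classical
  obtain ⟨ι, b, rfl⟩ := hM
  obtain ⟨S, rfl⟩ := hF
  let s : Finset ι := S.biUnion fun x => (b.repr x).support
  have hS : Submodule.span ℂ (S : Set V) ≤ Submodule.span ℂ (b '' (s : Set ι)) := by
    rw [Submodule.span_le]
    intro x hx
    rw [SetLike.mem_coe, b.mem_span_image]
    intro i hi
    exact Finset.mem_coe.2 (Finset.mem_biUnion.2 ⟨x, hx, hi⟩)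
  refine fg_of_le (N := AddSubgroup.closure (b '' (s : Set ι))) ?_
    (show AddSubgroup.FG _ from ⟨s.image b, by rw [Finset.coe_image]⟩)
  rintro m ⟨hm, hmS⟩
  have hsupp := b.mem_span_image.1 (hS hmS)
  rw [← b.linearCombination_repr m, Finsupp.linearCombination_apply]
  refine AddSubgroup.sum_mem _ fun i hi => ?_
  obtain ⟨k, hk⟩ := exists_int_repr b hm i
  simp only [hk, Int.cast_smul_eq_zsmul]
  exact AddSubgroup.zsmul_mem _ (AddSubgroup.subset_closure (Set.mem_image_of_mem b (hsupp hi))) _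

/-- The case `k = 1` makes `c` rational; then every power of its denominator divides the fixed
nonzero `n`, which forces the denominator to be `1`. -/
lemma exists_int_of_forall_pow {c : ℂ} {n : ℤ} (hn : n ≠ 0)
    (h : ∀ k : ℕ, ∃ m : ℤ, c ^ k * n = m) : ∃ m : ℤ, c = m := by
  have hn' : (n : ℂ) ≠ 0 := by exact_mod_cast hn
  obtain ⟨m, hm⟩ := h 1
  obtain ⟨q, hq⟩ : ∃ q : ℚ, c = q := ⟨m / n, by
    push_cast
    rw [eq_div_iff hn', ← hm, pow_one]⟩
  have hden : ∀ k : ℕ, ((q.den ^ k : ℕ) : ℤ) ∣ n := fun k => by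
    obtain ⟨m, hm⟩ := h k
    have h1 : q ^ k = (m : ℚ) / n := by
      rw [eq_div_iff (by exact_mod_cast hn)]
      rw [hq] at hm
      exact_mod_cast hm
    rw [← Rat.den_pow, h1]
    rw [← Rat.divInt_eq_div]
    exact Rat.den_dvd m n
  have h1 : q.den = 1 := by
    by_contra hne
    have h2 : 2 ≤ q.den := by have := q.den_pos; omega
    -- The exponent `|n|` suffices: a denominator `d ≥ 2` would give `|n| < 2 ^ |n| ≤ d ^ |n| ≤
    -- |n|`.
    have h3 := Nat.le_of_dvd (Int.natAbs_pos.2 hn) (Int.natCast_dvd.1 (hden n.natAbs))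
    have h4 := Nat.pow_le_pow_left h2 n.natAbs
    have h5 := Nat.lt_two_pow_self (n := n.natAbs)
    omega
  exact ⟨q.num, by rw [hq]; exact_mod_cast (Rat.coe_int_num_of_den_eq_one h1).symm⟩

/-- The unit need not be a basis vector, but it has a nonzero integer coordinate `n`. The same
coordinate of the power `c ^ k • 1`, which stays in the ring, is `c ^ k * n`. -/
lemma IsIntegralForm.exists_int_of_algebraMap_mem {B : Type v} [Ring B] [Nontrivial B]
    [Algebra ℂ B] {R : Subring B} (hR : IsIntegralForm R.toAddSubgroup) {c : ℂ}
    (hc : algebraMap ℂ B c ∈ R) : ∃ m : ℤ, c = m := by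
  obtain ⟨ι, b, hb⟩ := hR
  have hrepr : ∀ x ∈ R, ∀ i, ∃ k : ℤ, b.repr x i = k := fun x hx i =>
    exists_int_repr b (hb ▸ (show x ∈ R.toAddSubgroup from hx)) i
  obtain ⟨i, hi⟩ : ∃ i, b.repr (1 : B) i ≠ 0 := by
    by_contra! h
    exact one_ne_zero (b.repr.map_eq_zero_iff.1 (Finsupp.ext h))
  obtain ⟨n, hn⟩ := hrepr 1 (one_mem R) i
  refine exists_int_of_forall_pow (n := n) (by rintro rfl; simp [hn] at hi) fun k => ?_
  obtain ⟨m, hm⟩ := hrepr _ (pow_mem hc k) i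
  refine ⟨m, ?_⟩
  rw [← hm, ← hn, ← map_pow, Algebra.algebraMap_eq_smul_one, map_smul, Finsupp.smul_apply,
    smul_eq_mul]

end IntegralForms

/-! ### Enveloping algebras and induced modules -/

section Enveloping

attribute [local instance 100] LieRing.ofAssociativeRing

variable {R L : Type*} [CommRing R] [LieRing L] [LieAlgebra R L]

lemma subalgebra_eq_top_of_ι_mem (S : Subalgebra R (UniversalEnvelopingAlgebra R L))
    (h : ∀ x, UniversalEnvelopingAlgebra.ι R x ∈ S) : S = ⊤ := by
  let f : L →ₗ⁅R⁆ S :=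
    { toFun := fun x => ⟨UniversalEnvelopingAlgebra.ι R x, h x⟩
      map_add' := fun x y => Subtype.ext (map_add _ x y)
      map_smul' := fun r x => Subtype.ext (map_smul _ r x)
      map_lie' := fun {x y} => Subtype.ext (LieHom.map_lie _ x y) }
  have : S.val.comp (UniversalEnvelopingAlgebra.lift R f) = AlgHom.id R _ := by
    apply UniversalEnvelopingAlgebra.hom_ext
    ext x
    simp only [LieHom.comp_apply, AlgHom.coe_toLieHom, AlgHom.comp_apply,
      UniversalEnvelopingAlgebra.lift_ι_apply]
    rfl
  rw [eq_top_iff]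
  intro x _
  rw [← AlgHom.id_apply (R := R) x, ← this]
  exact (UniversalEnvelopingAlgebra.lift R f x).2

/-- The elements whose left multiplication preserves `S` form a subalgebra containing the
generators. -/
lemma submodule_eq_top_of_ι_mul_mem (S : Submodule R (UniversalEnvelopingAlgebra R L))
    (h1 : 1 ∈ S) (h : ∀ x, ∀ a ∈ S, UniversalEnvelopingAlgebra.ι R x * a ∈ S) : S = ⊤ := by
  let T : Subalgebra R (UniversalEnvelopingAlgebra R L) :=
    { carrier := {b | ∀ a ∈ S, b * a ∈ S}
      mul_mem' := fun {b c} hb hc a ha => by rw [mul_assoc]; exact hb _ (hc _ ha)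
      add_mem' := fun {b c} hb hc a ha => by rw [add_mul]; exact S.add_mem (hb _ ha) (hc _ ha)
      algebraMap_mem' := fun r a ha => by
        rw [← Algebra.smul_def]; exact S.smul_mem r ha }
  have hT := subalgebra_eq_top_of_ι_mem T h
  rw [eq_top_iff]
  intro b _
  have : b ∈ T := hT ▸ Algebra.mem_top
  simpa using this 1 h1

variable {U : Type*} [AddCommGroup U] [Module R U] (K' K : LieSubalgebra R L)
  (α : K →ₗ⁅R⁆ Module.End R U)

/-- The action of `K'` on linear maps from `L` to a `U(K')`-module. -/
def homAction (M : Type*) [AddCommGroup M] [Module R M]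
    [Module (UniversalEnvelopingAlgebra R K') M]
    [IsScalarTower R (UniversalEnvelopingAlgebra R K') M] :
    K' →ₗ⁅R⁆ Module.End R (L →ₗ[R] M) where
  toFun y := LinearMap.compRight R (Algebra.lsmul R R M (UniversalEnvelopingAlgebra.ι R y)) -
    LinearMap.lcomp R M (LieAlgebra.ad R L (y : L) : L →ₗ[R] L)
  map_add' y y' := by
    ext D z
    simp
    abel
  map_smul' r y := by
    ext D z
    simp [smul_sub]
  map_lie' {y y'} := by
    ext D z
    simp [LieRing.of_associative_ring_bracket, smul_sub]
    abel

lemma homAction_apply (M : Type*) [AddCommGroup M] [Module R M]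
    [Module (UniversalEnvelopingAlgebra R K') M]
    [IsScalarTower R (UniversalEnvelopingAlgebra R K') M] (y : K') (D : L →ₗ[R] M) (z : L) :
    homAction K' M y D z = UniversalEnvelopingAlgebra.ι R y • D z + D ⁅z, (y : L)⁆ := by
  rw [← lie_skew z (y : L), map_neg, ← sub_eq_add_neg]
  rfl

variable (p' : L →ₗ[R] K') (p : L →ₗ[R] K)

/-- The linear map `U → Hom(L, U(K') ⊗ U)` describing the action of `L` on `1 ⊗ U`. -/
def inducedBase : U →ₗ[R] L →ₗ[R] UniversalEnvelopingAlgebra R K' ⊗[R] U :=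
  LinearMap.mk₂ R (fun u z => 1 ⊗ₜ[R] α (p z) u + UniversalEnvelopingAlgebra.ι R (p' z) ⊗ₜ[R] u)
    (fun u u' z => by simp only [map_add, TensorProduct.tmul_add]; abel)
    (fun r u z => by simp only [map_smul, TensorProduct.tmul_smul, smul_add])
    (fun u z z' => by
      simp only [map_add, LinearMap.add_apply, TensorProduct.tmul_add, TensorProduct.add_tmul]
      abel)
    (fun r u z => by
      simp only [map_smul, LinearMap.smul_apply, TensorProduct.tmul_smul, TensorProduct.smul_tmul',
        smul_add])

/-- For a Lie algebra `L = K' + K` and a `K`-module `U`, the action of `L` on `U(K') ⊗ U`. -/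
def inducedAction : L →ₗ[R] Module.End R (UniversalEnvelopingAlgebra R K' ⊗[R] U) :=
  LinearMap.flip (TensorProduct.lift
    ((LinearMap.lcomp R _ (inducedBase K' K α p' p)) ∘ₗ
      (UniversalEnvelopingAlgebra.lift R
        (homAction K' (UniversalEnvelopingAlgebra R K' ⊗[R] U))).toLinearMap))

lemma inducedAction_tmul (z : L) (a : UniversalEnvelopingAlgebra R K') (u : U) :
    inducedAction K' K α p' p z (a ⊗ₜ u) = UniversalEnvelopingAlgebra.lift R
        (homAction K' (UniversalEnvelopingAlgebra R K' ⊗[R] U)) a (inducedBase K' K α p' p u) z :=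
  rfl

lemma inducedAction_one_tmul (z : L) (u : U) :
    inducedAction K' K α p' p z (1 ⊗ₜ u) =
      1 ⊗ₜ[R] α (p z) u + UniversalEnvelopingAlgebra.ι R (p' z) ⊗ₜ[R] u := by
  rw [inducedAction_tmul, map_one]
  rfl

/-- This commutation rule determines the action from its values on `1 ⊗ U`. It moves `z` past `y` at
the price of the bracket, which need not lie in `K'`; hence `K'` is made to act on maps defined on
all of `L`. -/
lemma inducedAction_ι_smul (z : L) (y : K') (w : UniversalEnvelopingAlgebra R K' ⊗[R] U) :
    inducedAction K' K α p' p z (UniversalEnvelopingAlgebra.ι R y • w) =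
      UniversalEnvelopingAlgebra.ι R y • inducedAction K' K α p' p z w +
        inducedAction K' K α p' p ⁅z, (y : L)⁆ w := by
  induction w with
  | zero => simp
  | add w w' h h' => simp only [smul_add, map_add, h, h']; abel
  | tmul a u =>
    rw [TensorProduct.smul_tmul', inducedAction_tmul, smul_eq_mul, map_mul,
      UniversalEnvelopingAlgebra.lift_ι_apply, Module.End.mul_apply, homAction_apply]
    rfl

lemma tmul_induction (P : Submodule R (UniversalEnvelopingAlgebra R K' ⊗[R] U))
    (h1 : ∀ u, 1 ⊗ₜ u ∈ P)
    (h2 : ∀ (y : K') w, w ∈ P → UniversalEnvelopingAlgebra.ι R y • w ∈ P) : P = ⊤ := by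
  rw [eq_top_iff, ← TensorProduct.span_tmul_eq_top, Submodule.span_le]
  rintro _ ⟨a, u, rfl⟩
  have := submodule_eq_top_of_ι_mul_mem
    (P.comap ((TensorProduct.mk R (UniversalEnvelopingAlgebra R K') U).flip u)) (h1 u)
    (fun y a ha => h2 y _ ha)
  have ha : a ∈ P.comap ((TensorProduct.mk R (UniversalEnvelopingAlgebra R K') U).flip u) :=
    this ▸ Submodule.mem_top
  exact ha

lemma inducedAction_coe (hp' : ∀ y : K', p' y = y) (hp0 : ∀ y : K', p y = 0)
    (y : K') (w : UniversalEnvelopingAlgebra R K' ⊗[R] U) :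
    inducedAction K' K α p' p y w = UniversalEnvelopingAlgebra.ι R y • w := by
  let P : Submodule R (UniversalEnvelopingAlgebra R K' ⊗[R] U) :=
    -- All `y` are treated at once because commuting past `y'` produces the bracket of `y` and `y'`.
    { carrier := {w | ∀ y : K', inducedAction K' K α p' p y w =
        UniversalEnvelopingAlgebra.ι R y • w}
      add_mem' := fun h h' y => by rw [map_add, h, h', smul_add]
      zero_mem' := fun y => by simp
      smul_mem' := fun r w h y => by rw [map_smul, h, smul_comm] }
  have : P = ⊤ := by
    refine tmul_induction K' P (fun u y => ?_) (fun y' w hw y => ?_)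
    · rw [inducedAction_one_tmul, hp', hp0, map_zero, LinearMap.zero_apply,
        TensorProduct.tmul_zero, zero_add, TensorProduct.smul_tmul', smul_eq_mul, mul_one]
    · rw [inducedAction_ι_smul, hw, ← LieSubalgebra.coe_bracket, hw, LieHom.map_lie,
        LieRing.of_associative_ring_bracket, sub_smul, mul_smul, mul_smul]
      abel
  exact (this ▸ Submodule.mem_top : w ∈ P) y

/-- On `1 ⊗ u` split both arguments along `K' + K`: brackets involving `K'` follow from the
commutation rule, brackets within `K` from `α` being a representation. The Jacobi identity carries
the relation from `w` to `ι y • w`. -/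
lemma inducedAction_lie (hp' : ∀ y : K', p' y = y) (hp0 : ∀ y : K', p y = 0)
    (hq : ∀ k : K, p k = k) (hq0 : ∀ k : K, p' k = 0)
    (hpq : ∀ z : L, (p' z : L) + p z = z)
    (z z' : L) (w : UniversalEnvelopingAlgebra R K' ⊗[R] U) :
    inducedAction K' K α p' p ⁅z, z'⁆ w =
      inducedAction K' K α p' p z (inducedAction K' K α p' p z' w) -
        inducedAction K' K α p' p z' (inducedAction K' K α p' p z w) := by
  set ρ := inducedAction K' K α p' p with hρ
  have hcoe : ∀ (y : K') w, ρ y w = UniversalEnvelopingAlgebra.ι R y • w :=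
    inducedAction_coe K' K α p' p hp' hp0
  have hι : ∀ z (y : K') w, ρ z (UniversalEnvelopingAlgebra.ι R y • w) =
      UniversalEnvelopingAlgebra.ι R y • ρ z w + ρ ⁅z, (y : L)⁆ w :=
    inducedAction_ι_smul K' K α p' p
  let P : Submodule R (UniversalEnvelopingAlgebra R K' ⊗[R] U) :=
    { carrier := {w | ∀ z z' : L, ρ ⁅z, z'⁆ w = ρ z (ρ z' w) - ρ z' (ρ z w)}
      add_mem' := fun h h' z z' => by simp only [map_add, h z z', h' z z']; abel
      zero_mem' := fun z z' => by simp
      smul_mem' := fun r w h z z' => by simp only [map_smul, h z z', smul_sub] }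
  have : P = ⊤ := by
    refine tmul_induction K' P (fun u z z' => ?_) (fun y w hw z z' => ?_)
    · have h1 : ∀ (y : K') z w, ρ ⁅z, (y : L)⁆ w = ρ z (ρ y w) - ρ y (ρ z w) := fun y z w => by
        rw [hcoe, hι, hcoe]; abel
      have h2 : ∀ (y : K') z w, ρ ⁅(y : L), z⁆ w = ρ y (ρ z w) - ρ z (ρ y w) := fun y z w => by
        rw [← lie_skew, map_neg, LinearMap.neg_apply, h1]; abel
      have h3 : ∀ (k : K) u, ρ k (1 ⊗ₜ u) = 1 ⊗ₜ[R] α k u := fun k u => by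
        rw [hρ, inducedAction_one_tmul, hq, hq0, map_zero, TensorProduct.zero_tmul, add_zero]
      have h4 : ∀ k k' : K, ρ ⁅(k : L), (k' : L)⁆ (1 ⊗ₜ u) =
          ρ k (ρ k' (1 ⊗ₜ u)) - ρ k' (ρ k (1 ⊗ₜ u)) := fun k k' => by
        rw [← LieSubalgebra.coe_bracket]
        simp only [h3]
        rw [LieHom.map_lie, LieRing.of_associative_ring_bracket, LinearMap.sub_apply,
          TensorProduct.tmul_sub]
        rfl
      rw [← hpq z, ← hpq z']
      simp only [add_lie, lie_add, map_add, LinearMap.add_apply, h1, h2, h4]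
      abel
    · have hj : ⁅⁅z, z'⁆, (y : L)⁆ = ⁅⁅z, (y : L)⁆, z'⁆ + ⁅z, ⁅z', (y : L)⁆⁆ := by
        rw [lie_lie, ← lie_skew ⁅z, (y : L)⁆ z']
        abel
      replace hw : ∀ z z' : L, ρ ⁅z, z'⁆ w = ρ z (ρ z' w) - ρ z' (ρ z w) := hw
      simp only [hι, map_add, hw, hj, LinearMap.add_apply, smul_sub]
      abel
  have hw : w ∈ P := this ▸ Submodule.mem_top
  exact hw _ _

/-- `inducedAction` as a homomorphism of Lie algebras. -/
def inducedHom (hp' : ∀ y : K', p' y = y) (hp0 : ∀ y : K', p y = 0)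
    (hq : ∀ k : K, p k = k) (hq0 : ∀ k : K, p' k = 0)
    (hpq : ∀ z : L, (p' z : L) + p z = z) :
    L →ₗ⁅R⁆ Module.End R (UniversalEnvelopingAlgebra R K' ⊗[R] U) where
  toLinearMap := inducedAction K' K α p' p
  map_lie' {z z'} := LinearMap.ext fun w =>
    inducedAction_lie K' K α p' p hp' hp0 hq hq0 hpq z z' w

end Enveloping

/-! ### Modes of the affine algebra and the scaling automorphism -/

section AffineModes

attribute [local instance 100] LieRing.ofAssociativeRing

variable {g : Type u} [LieRing g] [LieAlgebra ℂ g] (κ : InvariantForm g)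

/-- `mode κ n` as a linear map. -/
def modeLin (n : ℤ) : g →ₗ[ℂ] Affine κ where
  toFun := mode κ n
  map_add' a b := by
    rw [mode, mode, mode, ← LieAlgebra.of_add]
    congr 1
    simp [TensorProduct.tmul_add]
  map_smul' r a := by
    rw [mode, mode, RingHom.id_apply, ← LieAlgebra.of_smul]
    congr 1
    simp

lemma mode_zero (n : ℤ) : mode κ n (0 : g) = 0 := map_zero (modeLin κ n)

/-- `LieAlgebra.ofProd` as a linear map. -/
def ofProdLin : LieAlgebra.loopAlgebra ℂ ℤ g ×
    TrivialLieModule ℂ (LieAlgebra.loopAlgebra ℂ ℤ g) ℂ →ₗ[ℂ] Affine κ where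
  toFun := LieAlgebra.ofProd (cocycle κ)
  map_add' _ _ := rfl
  map_smul' _ _ := rfl

lemma submodule_eq_top_of_mode_mem (S : Submodule ℂ (Affine κ)) (h : ∀ n a, mode κ n a ∈ S)
    (hk : central κ ∈ S) : S = ⊤ := by
  have h1 : ∀ f : ℤ →₀ g, ofProdLin κ ((LieAlgebra.LoopAlgebra.toFinsupp ℂ ℤ g).symm f, 0) ∈ S := by
    intro f
    induction f using Finsupp.induction_linear with
    | zero => rw [map_zero, show ((0 : LieAlgebra.loopAlgebra ℂ ℤ g),
        (0 : TrivialLieModule ℂ (LieAlgebra.loopAlgebra ℂ ℤ g) ℂ)) = 0 from rfl, map_zero]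
              exact S.zero_mem
    | add f f' h h' =>
      rw [map_add, ← add_zero (0 : TrivialLieModule ℂ (LieAlgebra.loopAlgebra ℂ ℤ g) ℂ),
        ← Prod.mk_add_mk, map_add]
      exact S.add_mem h h'
    | single n a =>
      rw [LieAlgebra.LoopAlgebra.toFinsupp_symm_single]
      exact h n a
  rw [eq_top_iff]
  intro x _
  obtain ⟨⟨f, c⟩, rfl⟩ := (LieAlgebra.ofProd (cocycle κ)).surjective x
  have h2 : LieAlgebra.ofProd (cocycle κ) (f, c) =
      ofProdLin κ (f, 0) + (TrivialLieModule.equiv ℂ _ ℂ c) • central κ := by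
    rw [central, ← LieAlgebra.of_smul]
    change _ = LieAlgebra.ofProd (cocycle κ) _ + _
    rw [← LieAlgebra.of_add]
    congr 1
    refine Prod.ext (by simp) ?_
    simp only [Prod.smul_mk, Prod.mk_add_mk, zero_add, ← map_smul]
    simp
  rw [h2]
  refine S.add_mem ?_ (S.smul_mem _ hk)
  have := h1 (LieAlgebra.LoopAlgebra.toFinsupp ℂ ℤ g f)
  rwa [LinearEquiv.symm_apply_apply] at this

lemma affine_ext {x y : Affine κ} (h : ∀ n, coeff κ n x = coeff κ n y)
    (hk : centralCoeff κ x = centralCoeff κ y) : x = y := by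
  apply (LieAlgebra.ofProd (cocycle κ)).symm.injective
  refine Prod.ext ?_ ((TrivialLieModule.equiv ℂ _ ℂ).injective hk)
  exact (LieAlgebra.LoopAlgebra.toFinsupp ℂ ℤ g).injective (Finsupp.ext h)

lemma mode_mem_minusPart {n : ℤ} (hn : n < 0) (a : g) : mode κ n a ∈ minusPart κ :=
  Submodule.subset_span ⟨n, hn, a, rfl⟩

lemma mode_mem_plusPart {n : ℤ} (hn : 0 < n) (a : g) : mode κ n a ∈ plusPart κ :=
  Submodule.subset_span ⟨n, hn, a, rfl⟩

lemma mode_mem_nonnegPart {n : ℤ} (hn : 0 ≤ n) (a : g) : mode κ n a ∈ nonnegPart κ :=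
  Submodule.subset_span (Or.inl ⟨n, hn, a, rfl⟩)

lemma central_mem_nonnegPart : central κ ∈ nonnegPart κ :=
  Submodule.subset_span (Or.inr rfl)

lemma plusPart_le_nonnegPart : plusPart κ ≤ nonnegPart κ := by
  change Submodule.span ℂ _ ≤ Submodule.span ℂ _
  refine Submodule.span_mono ?_
  rintro _ ⟨n, hn, a, rfl⟩
  exact Or.inl ⟨n, le_of_lt hn, a, rfl⟩

lemma coeff_eq_zero_of_mem_minusPart {x : Affine κ} (hx : x ∈ minusPart κ) {n : ℤ} (hn : 0 ≤ n) :
    coeff κ n x = 0 := by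
  have : (minusPart κ).toSubmodule ≤ LinearMap.ker (coeff κ n) := by
    refine Submodule.span_le.2 ?_
    rintro _ ⟨m, hm, a, rfl⟩
    simp only [SetLike.mem_coe, LinearMap.mem_ker, coeff_mode]
    exact if_neg (by omega)
  exact this hx

lemma centralCoeff_eq_zero_of_mem_minusPart {x : Affine κ} (hx : x ∈ minusPart κ) :
    centralCoeff κ x = 0 := by
  have : (minusPart κ).toSubmodule ≤ LinearMap.ker (centralCoeff κ) := by
    refine Submodule.span_le.2 ?_
    rintro _ ⟨m, hm, a, rfl⟩
    simp
  exact this hx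

lemma coeff_eq_zero_of_mem_plusPart {x : Affine κ} (hx : x ∈ plusPart κ) {n : ℤ} (hn : n ≤ 0) :
    coeff κ n x = 0 := by
  have : (plusPart κ).toSubmodule ≤ LinearMap.ker (coeff κ n) := by
    refine Submodule.span_le.2 ?_
    rintro _ ⟨m, hm, a, rfl⟩
    simp only [SetLike.mem_coe, LinearMap.mem_ker, coeff_mode]
    exact if_neg (by omega)
  exact this hx

lemma centralCoeff_eq_zero_of_mem_plusPart {x : Affine κ} (hx : x ∈ plusPart κ) :
    centralCoeff κ x = 0 := by
  have : (plusPart κ).toSubmodule ≤ LinearMap.ker (centralCoeff κ) := by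
    refine Submodule.span_le.2 ?_
    rintro _ ⟨m, hm, a, rfl⟩
    simp
  exact this hx

lemma coeff_eq_zero_of_mem_nonnegPart {x : Affine κ} (hx : x ∈ nonnegPart κ) {n : ℤ}
    (hn : n < 0) : coeff κ n x = 0 := by
  have : (nonnegPart κ).toSubmodule ≤ LinearMap.ker (coeff κ n) := by
    refine Submodule.span_le.2 ?_
    rintro _ (⟨m, hm, a, rfl⟩ | rfl)
    · simp only [SetLike.mem_coe, LinearMap.mem_ker, coeff_mode]
      exact if_neg (by omega)
    · simp
  exact this hx

lemma isCompl_minusPart_nonnegPart :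
    IsCompl (minusPart κ).toSubmodule (nonnegPart κ).toSubmodule := by
  refine ⟨Submodule.disjoint_def.2 fun x hx hx' => ?_, codisjoint_iff.2 ?_⟩
  · refine affine_ext κ (fun n => ?_) ?_
    · rw [map_zero]
      rcases lt_or_ge n 0 with hn | hn
      · exact coeff_eq_zero_of_mem_nonnegPart κ hx' hn
      · exact coeff_eq_zero_of_mem_minusPart κ hx hn
    · rw [map_zero]
      exact centralCoeff_eq_zero_of_mem_minusPart κ hx
  · refine submodule_eq_top_of_mode_mem κ _ (fun n a => ?_) ?_
    · rcases lt_or_ge n 0 with hn | hn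
      · exact Submodule.mem_sup_left (mode_mem_minusPart κ hn a)
      · exact Submodule.mem_sup_right (mode_mem_nonnegPart κ hn a)
    · exact Submodule.mem_sup_right (central_mem_nonnegPart κ)

/-- The linear endomorphism of `ĝ` multiplying `a ⊗ t^n` by `2^n` and fixing `k`. -/
def scaleLin : Affine κ →ₗ[ℂ] Affine κ where
  toFun x := ofProdLin κ ((LieAlgebra.LoopAlgebra.toFinsupp ℂ ℤ g).symm
    (Finsupp.lsum ℂ (fun n : ℤ => ((2 : ℂ) ^ n) • Finsupp.lsingle (R := ℂ) (M := g) n)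
      (LieAlgebra.LoopAlgebra.toFinsupp ℂ ℤ g ((LieAlgebra.ofProd (cocycle κ)).symm x).1)),
    ((LieAlgebra.ofProd (cocycle κ)).symm x).2)
  map_add' x y := by
    rw [← map_add, LieAlgebra.of_symm_add, Prod.fst_add, Prod.snd_add, Prod.mk_add_mk]
    simp only [map_add]
  map_smul' r x := by
    rw [← map_smul, LieAlgebra.of_symm_smul, Prod.smul_fst, Prod.smul_snd, Prod.smul_mk]
    simp only [map_smul, RingHom.id_apply]

lemma scaleLin_mode (n : ℤ) (a : g) : scaleLin κ (mode κ n a) = (2 : ℂ) ^ n • mode κ n a := by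
  simp only [scaleLin, mode, LinearMap.coe_mk, AddHom.coe_mk, Equiv.symm_apply_apply,
    LieAlgebra.LoopAlgebra.toFinsupp_single_tmul]
  rw [← LieAlgebra.of_smul]
  simp only [Finsupp.lsum_single, LinearMap.smul_apply, Finsupp.lsingle_apply, map_smul,
    LieAlgebra.LoopAlgebra.toFinsupp_symm_single, Prod.smul_mk, smul_zero]
  rfl

lemma scaleLin_central : scaleLin κ (central κ) = central κ := by
  simp only [scaleLin, central, LinearMap.coe_mk, AddHom.coe_mk, Equiv.symm_apply_apply, map_zero]
  rfl

/-- The automorphism of `ĝ` multiplying `a ⊗ t^n` by `2^n` and fixing `k`, as a homomorphism. -/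
def scale : Affine κ →ₗ⁅ℂ⁆ Affine κ where
  toLinearMap := scaleLin κ
  map_lie' {x y} := by
    change scaleLin κ ⁅x, y⁆ = ⁅scaleLin κ x, scaleLin κ y⁆
    have h1 : ∀ n a y, scaleLin κ ⁅mode κ n a, y⁆ = ⁅scaleLin κ (mode κ n a), scaleLin κ y⁆ := by
      intro n a y
      let S : Submodule ℂ (Affine κ) :=
        { carrier := {y | scaleLin κ ⁅mode κ n a, y⁆ = ⁅scaleLin κ (mode κ n a), scaleLin κ y⁆}
          add_mem' := fun {y y'} h h' => by
            simp only [Set.mem_ofPred_eq] at h h' ⊢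
            rw [lie_add, map_add, h, h', map_add, lie_add]
          zero_mem' := by simp
          smul_mem' := fun r y h => by
            simp only [Set.mem_ofPred_eq] at h ⊢
            rw [lie_smul, map_smul, h, map_smul, lie_smul] }
      have : S = ⊤ := by
        refine submodule_eq_top_of_mode_mem κ S (fun m b => ?_) ?_
        · change scaleLin κ ⁅mode κ n a, mode κ m b⁆ =
            ⁅scaleLin κ (mode κ n a), scaleLin κ (mode κ m b)⁆
          simp only [scaleLin_mode, lie_smul, smul_lie, lie_mode_mode, map_add, map_smul,
            scaleLin_central, smul_add, smul_smul]
          rw [zpow_add₀ (two_ne_zero' ℂ), mul_comm ((2 : ℂ) ^ n)]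
          congr 2
          split_ifs with h
          · rw [← mul_assoc, ← zpow_add₀ (two_ne_zero' ℂ), add_comm m n, h, zpow_zero, one_mul]
          · simp
        · change scaleLin κ ⁅mode κ n a, central κ⁆ =
            ⁅scaleLin κ (mode κ n a), scaleLin κ (central κ)⁆
          rw [scaleLin_central, lie_central, lie_central, map_zero]
      exact (this ▸ Submodule.mem_top : y ∈ S)
    let S : Submodule ℂ (Affine κ) :=
      { carrier := {x | scaleLin κ ⁅x, y⁆ = ⁅scaleLin κ x, scaleLin κ y⁆}
        add_mem' := fun {x x'} h h' => by
          simp only [Set.mem_ofPred_eq] at h h' ⊢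
          rw [add_lie, map_add, h, h', map_add, add_lie]
        zero_mem' := by simp
        smul_mem' := fun r x h => by
          simp only [Set.mem_ofPred_eq] at h ⊢
          rw [smul_lie, map_smul, h, map_smul, smul_lie] }
    have : S = ⊤ := by
      refine submodule_eq_top_of_mode_mem κ S (fun m b => h1 m b y) ?_
      change scaleLin κ ⁅central κ, y⁆ = ⁅scaleLin κ (central κ), scaleLin κ y⁆
      rw [scaleLin_central, central_lie, central_lie, map_zero]
    exact (this ▸ Submodule.mem_top : x ∈ S)

lemma scale_mode (n : ℤ) (a : g) : scale κ (mode κ n a) = (2 : ℂ) ^ n • mode κ n a :=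
  scaleLin_mode κ n a

lemma scale_central : scale κ (central κ) = central κ := scaleLin_central κ

/-- The algebra endomorphism of `U(ĝ)` induced by `scale`. -/
def scaleEnv : Env κ →ₐ[ℂ] Env κ :=
  UniversalEnvelopingAlgebra.lift ℂ ((UniversalEnvelopingAlgebra.ι ℂ).comp (scale κ))

lemma scaleEnv_ι (x : Affine κ) : scaleEnv κ (UniversalEnvelopingAlgebra.ι ℂ x) =
    UniversalEnvelopingAlgebra.ι ℂ (scale κ x) :=
  UniversalEnvelopingAlgebra.lift_ι_apply _ _ _

lemma envMap_ι (K : LieSubalgebra ℂ (Affine κ)) (x : K) :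
    envMap κ K (UniversalEnvelopingAlgebra.ι ℂ x) = UniversalEnvelopingAlgebra.ι ℂ (x : Affine κ) :=
  UniversalEnvelopingAlgebra.lift_ι_apply _ _ _

/-- Degree becomes an eigenvalue. The number `2` serves because its integer powers are nonzero and
pairwise distinct. -/
lemma scaleEnv_envMap {K : LieSubalgebra ℂ (Affine κ)} {n : ℤ}
    {x : UniversalEnvelopingAlgebra ℂ K} (hx : x ∈ envDegree κ K n) :
    scaleEnv κ (envMap κ K x) = (2 : ℂ) ^ n • envMap κ K x := by
  induction hx using Submodule.span_induction with
  | zero => simp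
  | add x y _ _ hx hy => simp only [map_add, hx, hy, smul_add]
  | smul r x _ hx => simp only [map_smul, hx]; rw [smul_comm]
  | mem x hx =>
    obtain ⟨l, hl, rfl, rfl⟩ := hx
    induction l with
    | nil => simp
    | cons p l ih =>
      obtain ⟨a, ha⟩ := hl p List.mem_cons_self
      simp only [List.map_cons, List.prod_cons, List.sum_cons, map_mul]
      rw [ih fun q hq => hl q (List.mem_cons_of_mem _ hq), envMap_ι, scaleEnv_ι, ha, scale_mode,
        map_smul, smul_mul_smul_comm, zpow_add₀ (two_ne_zero' ℂ)]

/-- The space of elements of degree `n` of `U(ĝ)`. -/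
def envEigen (n : ℤ) : Submodule ℂ (Env κ) :=
  Module.End.eigenspace (scaleEnv κ).toLinearMap ((2 : ℂ) ^ n)

lemma mem_envEigen {n : ℤ} {x : Env κ} : x ∈ envEigen κ n ↔ scaleEnv κ x = (2 : ℂ) ^ n • x :=
  Module.End.mem_eigenspace_iff

/-- Modes and `k` are homogeneous and degrees add under products, so the sum of the eigenspaces is
stable under multiplication by generators. -/
lemma iSup_envEigen : ⨆ n, envEigen κ n = ⊤ := by
  refine submodule_eq_top_of_ι_mul_mem _ ?_ fun x a ha => ?_
  · exact Submodule.mem_iSup_of_mem 0 ((mem_envEigen κ).2 (by simp))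
  · have h1 : ∀ m : ℤ, ∀ y : Env κ, y ∈ envEigen κ m → y * a ∈ ⨆ n, envEigen κ n := by
      intro m y hy
      induction ha using Submodule.iSup_induction' with
      | mem n a ha =>
        refine Submodule.mem_iSup_of_mem (m + n) ((mem_envEigen κ).2 ?_)
        rw [map_mul, (mem_envEigen κ).1 hy, (mem_envEigen κ).1 ha, smul_mul_smul_comm,
          zpow_add₀ (two_ne_zero' ℂ)]
      | zero => rw [mul_zero]; exact Submodule.zero_mem _
      | add a a' _ _ h h' => rw [mul_add]; exact Submodule.add_mem _ h h'
    let S : Submodule ℂ (Affine κ) := (⨆ n, envEigen κ n).comap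
      ((LinearMap.mulRight ℂ a).comp (UniversalEnvelopingAlgebra.ι ℂ (L := Affine κ)).toLinearMap)
    have : S = ⊤ := by
      refine submodule_eq_top_of_mode_mem κ S (fun n b => ?_) ?_
      · exact h1 n (UniversalEnvelopingAlgebra.ι ℂ (mode κ n b)) ((mem_envEigen κ).2 (by rw [scaleEnv_ι, scale_mode, map_smul]))
      · exact h1 0 (UniversalEnvelopingAlgebra.ι ℂ (central κ)) ((mem_envEigen κ).2 (by rw [scaleEnv_ι, scale_central, zpow_zero, one_smul]))
    exact (this ▸ Submodule.mem_top : x ∈ S)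

end AffineModes

/-! ### Degrees in the enveloping algebras of `ĝ₋` and `ĝ₊` -/

section Degrees

attribute [local instance 100] LieRing.ofAssociativeRing

variable {g : Type u} [LieRing g] [LieAlgebra ℂ g] (κ : InvariantForm g)

lemma IsCompatible.eq_iSup {V : Type u} [AddCommGroup V] [Module ℂ V] {M : AddSubgroup V}
    {W : ℤ → Submodule ℂ V} (h : IsCompatible M W) : M = ⨆ n, M ⊓ (W n).toAddSubgroup := by
  classical
  refine le_antisymm (fun m hm => ?_) (iSup_le fun n => inf_le_left)
  obtain ⟨x, hx⟩ := h.2 ⟨m, hm⟩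
  replace hx := congrArg Subtype.val hx
  rw [show m = M.subtype (DirectSum.coeAddMonoidHom
    (fun n => (W n).toAddSubgroup.addSubgroupOf M) x) from hx.symm]
  clear hx
  induction x using DirectSum.induction_on with
  | zero => rw [map_zero, map_zero]; exact AddSubgroup.zero_mem _
  | add x y hx hy => rw [map_add, map_add]; exact AddSubgroup.add_mem _ hx hy
  | of n x =>
    rw [DirectSum.coeAddMonoidHom_of]
    exact AddSubgroup.mem_iSup_of_mem n ⟨(x : M).2, x.2⟩

/-- In `envDegree` the zero vector may carry any degree label, so factors whose label has the wrong
sign have to be recognized as zero. -/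
lemma mode_eq_zero_of_mem_minusPart {n : ℤ} (hn : 0 ≤ n) {a : g} (h : mode κ n a ∈ minusPart κ) :
    mode κ n a = 0 := by
  have := coeff_eq_zero_of_mem_minusPart κ h hn
  rw [coeff_mode, if_pos rfl] at this
  rw [this, mode_zero]

lemma mode_eq_zero_of_mem_plusPart {n : ℤ} (hn : n ≤ 0) {a : g} (h : mode κ n a ∈ plusPart κ) :
    mode κ n a = 0 := by
  have := coeff_eq_zero_of_mem_plusPart κ h hn
  rw [coeff_mode, if_pos rfl] at this
  rw [this, mode_zero]

/-- The span of the elements `a ⊗ t^{-(k+1)}` of `U(ĝ₋)`. -/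
def minusGen (k : ℕ) : Submodule ℂ (UniversalEnvelopingAlgebra ℂ (minusPart κ)) :=
  LinearMap.range ((UniversalEnvelopingAlgebra.ι ℂ (L := minusPart κ)).toLinearMap ∘ₗ
    (modeLin κ (-(k + 1 : ℤ))).codRestrict (minusPart κ).toSubmodule
      fun a => mode_mem_minusPart κ (by omega) a)

lemma fg_minusGen [FiniteDimensional ℂ g] (k : ℕ) : (minusGen κ k).FG := by
  rw [minusGen, LinearMap.range_eq_map]
  exact Module.Finite.fg_top.map _

/-- A finite-dimensional space containing `U(ĝ₋)_{-n}`, defined by recursion on `n`. -/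
def minusBound : ℕ → Submodule ℂ (UniversalEnvelopingAlgebra ℂ (minusPart κ))
  | 0 => Submodule.span ℂ {1}
  | n + 1 => ⨆ k : Fin (n + 1), minusGen κ k * minusBound (n - k)

lemma fg_minusBound [FiniteDimensional ℂ g] (n : ℕ) : (minusBound κ n).FG := by
  induction n using Nat.strong_induction_on with
  | _ n ih =>
    cases n with
    | zero => rw [minusBound]; exact Submodule.fg_span_singleton 1
    | succ n =>
      rw [minusBound]
      exact Submodule.fg_iSup _ fun k => (fg_minusGen κ k).mul (ih _ (by omega))

lemma envDegree_minusPart_aux (l : List (ℤ × minusPart κ))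
    (hl : ∀ p ∈ l, ∃ a : g, (p.2 : Affine κ) = mode κ p.1 a) :
    (l.map fun p => UniversalEnvelopingAlgebra.ι ℂ p.2).prod = 0 ∨
      ∃ n : ℕ, (l.map Prod.fst).sum = -n ∧
        (l.map fun p => UniversalEnvelopingAlgebra.ι ℂ p.2).prod ∈ minusBound κ n := by
  induction l with
  | nil =>
    refine Or.inr ⟨0, by simp, ?_⟩
    rw [minusBound]
    exact Submodule.subset_span rfl
  | cons p l ih =>
    simp only [List.map_cons, List.prod_cons, List.sum_cons]
    obtain ⟨a, ha⟩ := hl p List.mem_cons_self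
    rcases ih fun q hq => hl q (List.mem_cons_of_mem _ hq) with h | ⟨n, hn, h⟩
    · exact Or.inl (by rw [h, mul_zero])
    rcases lt_or_ge p.1 0 with hp | hp
    · obtain ⟨k, hk⟩ : ∃ k : ℕ, p.1 = -(k + 1 : ℤ) := ⟨(-p.1 - 1).toNat, by omega⟩
      -- A factor of degree `-(k + 1)` in front of a product of degree `-n`.
      refine Or.inr ⟨n + k + 1, by rw [hn, hk]; push_cast; ring, ?_⟩
      rw [minusBound]
      refine Submodule.mem_iSup_of_mem ⟨k, by omega⟩ (Submodule.mul_mem_mul ?_ ?_)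
      · refine ⟨a, ?_⟩
        change UniversalEnvelopingAlgebra.ι ℂ _ = _
        congr 1
        refine Subtype.ext ?_
        rw [ha, hk]
        rfl
      · simpa using h
    · left
      have : p.2 = 0 := Subtype.ext (by
        rw [ha]
        exact mode_eq_zero_of_mem_minusPart κ hp (ha ▸ p.2.2))
      rw [this, map_zero, zero_mul]

lemma envDegree_minusPart_le (n : ℕ) : envDegree κ (minusPart κ) (-n) ≤ minusBound κ n := by
  refine Submodule.span_le.2 ?_
  rintro _ ⟨l, hl, hn, rfl⟩
  rcases envDegree_minusPart_aux κ l hl with h | ⟨m, hm, h⟩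
  · rw [h]; exact Submodule.zero_mem _
  · obtain rfl : m = n := by omega
    exact h

lemma envDegree_minusPart_eq_bot {n : ℤ} (hn : 0 < n) : envDegree κ (minusPart κ) n = ⊥ := by
  refine (Submodule.eq_bot_iff _).2 fun x hx => ?_
  induction hx using Submodule.span_induction with
  | zero => rfl
  | add x y _ _ hx hy => rw [hx, hy, add_zero]
  | smul r x _ hx => rw [hx, smul_zero]
  | mem x hx =>
    obtain ⟨l, hl, hn', rfl⟩ := hx
    rcases envDegree_minusPart_aux κ l hl with h | ⟨m, hm, h⟩
    · exact h
    · omega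

/-- Every nonzero factor lowers the degree by at least one, so monomials of a fixed degree have
bounded length and come from finitely many copies of `g`. -/
lemma fg_envDegree_minusPart [FiniteDimensional ℂ g] (n : ℤ) :
    (envDegree κ (minusPart κ) n).FG := by
  rcases lt_or_ge 0 n with hn | hn
  · rw [envDegree_minusPart_eq_bot κ hn]; exact Submodule.fg_bot
  · obtain ⟨m, rfl⟩ : ∃ m : ℕ, n = -m := ⟨(-n).toNat, by omega⟩
    have : IsNoetherian ℂ (minusBound κ m) := isNoetherian_of_fg_of_noetherian _ (fg_minusBound κ m)
    exact isNoetherian_submodule.1 this _ (envDegree_minusPart_le κ m)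

/-- The augmentation of the universal enveloping algebra of a Lie algebra. -/
def augmentation (L : Type*) [LieRing L] [LieAlgebra ℂ L] :
    UniversalEnvelopingAlgebra ℂ L →ₐ[ℂ] ℂ :=
  UniversalEnvelopingAlgebra.lift ℂ 0

lemma augmentation_ι {L : Type*} [LieRing L] [LieAlgebra ℂ L] (x : L) :
    augmentation L (UniversalEnvelopingAlgebra.ι ℂ x) = 0 :=
  UniversalEnvelopingAlgebra.lift_ι_apply _ _ _

instance {L : Type*} [LieRing L] [LieAlgebra ℂ L] : Nontrivial (UniversalEnvelopingAlgebra ℂ L) :=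
  (augmentation L).toRingHom.domain_nontrivial

lemma augmentation_eq_zero {K : LieSubalgebra ℂ (Affine κ)} {n : ℤ} (hn : n ≠ 0)
    {x : UniversalEnvelopingAlgebra ℂ K} (hx : x ∈ envDegree κ K n) : augmentation K x = 0 := by
  induction hx using Submodule.span_induction with
  | zero => rw [map_zero]
  | add x y _ _ hx hy => rw [map_add, hx, hy, add_zero]
  | smul r x _ hx => rw [map_smul, hx, smul_zero]
  | mem x hx =>
    obtain ⟨l, -, rfl, rfl⟩ := hx
    cases l with
    | nil => simp at hn
    | cons p l => rw [List.map_cons, List.prod_cons, map_mul, augmentation_ι, zero_mul]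

/-- Nonzero factors from `ĝ₊` have positive degree, so only the empty monomial contributes in degree
`0`: this part consists of scalars. -/
lemma algebraMap_augmentation {x : UniversalEnvelopingAlgebra ℂ (plusPart κ)}
    (hx : x ∈ envDegree κ (plusPart κ) 0) :
    algebraMap ℂ _ (augmentation (plusPart κ) x) = x := by
  induction hx using Submodule.span_induction with
  | zero => rw [map_zero, map_zero]
  | add x y _ _ hx hy => rw [map_add, map_add, hx, hy]
  | smul r x _ hx => rw [map_smul, smul_eq_mul, map_mul, hx, Algebra.smul_def]
  | mem x hx =>
    obtain ⟨l, hl, hn, rfl⟩ := hx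
    have : (l.map fun p => UniversalEnvelopingAlgebra.ι ℂ p.2).prod = 0 ∨
        (0 ≤ (l.map Prod.fst).sum ∧ (l ≠ [] → 0 < (l.map Prod.fst).sum)) := by
      clear hn
      induction l with
      | nil => simp
      | cons p l ih =>
        simp only [List.map_cons, List.prod_cons, List.sum_cons]
        obtain ⟨a, ha⟩ := hl p List.mem_cons_self
        rcases ih fun q hq => hl q (List.mem_cons_of_mem _ hq) with h | ⟨h, -⟩
        · exact Or.inl (by rw [h, mul_zero])
        rcases lt_or_ge 0 p.1 with hp | hp
        · exact Or.inr ⟨by omega, fun _ => by omega⟩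
        · left
          have : p.2 = 0 := Subtype.ext (by
            rw [ha]
            exact mode_eq_zero_of_mem_plusPart κ hp (ha ▸ p.2.2))
          rw [this, map_zero, zero_mul]
    rcases this with h | ⟨-, h⟩
    · rw [h, map_zero, map_zero]
    · obtain rfl : l = [] := by
        by_contra hne
        have := h hne
        omega
      simp

variable {κ}

/-- By gradedness the degree `0` component of `c` again lies in `U_ℤ(ĝ₊)`. It is a scalar, hence an
integer, and the other components have augmentation `0`. -/
lemma IntegralEnvelope.exists_int_augmentation (A : IntegralEnvelope κ)
    {c : UniversalEnvelopingAlgebra ℂ (plusPart κ)} (hc : c ∈ A.plus) :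
    ∃ m : ℤ, augmentation (plusPart κ) c = m := by
  have hc' : c ∈ ⨆ n, A.plus.toAddSubgroup ⊓ (envDegree κ (plusPart κ) n).toAddSubgroup :=
    A.plus_graded.eq_iSup ▸ (show c ∈ A.plus.toAddSubgroup from hc)
  clear hc
  induction hc' using AddSubgroup.iSup_induction' with
  | hp n x hx =>
    obtain ⟨hx, hxn⟩ := hx
    rcases eq_or_ne n 0 with rfl | hn
    · refine A.plus_form.exists_int_of_algebraMap_mem ?_
      rw [algebraMap_augmentation κ hxn]
      exact hx
    · exact ⟨0, by rw [augmentation_eq_zero κ hn hxn, Int.cast_zero]⟩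
  | h1 => exact ⟨0, by simp⟩
  | hadd x y _ _ hx hy =>
    obtain ⟨k, hk⟩ := hx
    obtain ⟨l, hl⟩ := hy
    exact ⟨k + l, by rw [map_add, hk, hl, Int.cast_add]⟩

end Degrees

/-! ### The generalized Verma module and its tensor model -/

section VermaModules

attribute [local instance 100] LieRing.ofAssociativeRing

variable {g : Type u} [LieRing g] [LieAlgebra ℂ g] (κ : InvariantForm g)
variable (ℓ : ℤ) (U : Type v) [AddCommGroup U] [Module ℂ U] [LieRingModule g U] [LieModule ℂ g U]

lemma envMap_nonneg_smul_vermaTop (b : UniversalEnvelopingAlgebra ℂ (nonnegPart κ)) (u : U) :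
    envMap κ (nonnegPart κ) b • vermaTop κ ℓ U u =
      vermaTop κ ℓ U (nonnegEnvAction κ ℓ U b u) := by
  have h : envMap κ (nonnegPart κ) b ⊗ₜ[ℂ] u - 1 ⊗ₜ[ℂ] nonnegEnvAction κ ℓ U b u ∈
      vermaRelations κ ℓ U := Submodule.subset_span ⟨b, u, rfl⟩
  rw [← Submodule.Quotient.mk_eq_zero, Submodule.Quotient.mk_sub, sub_eq_zero] at h
  change envMap κ (nonnegPart κ) b • Submodule.Quotient.mk (1 ⊗ₜ[ℂ] u) =
    Submodule.Quotient.mk (1 ⊗ₜ[ℂ] nonnegEnvAction κ ℓ U b u)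
  rw [← h, ← Submodule.Quotient.mk_smul, TensorProduct.smul_tmul', smul_eq_mul, mul_one]

lemma mk_tmul (x : Env κ) (u : U) :
    (Submodule.Quotient.mk (x ⊗ₜ[ℂ] u) : Verma κ ℓ U) = x • vermaTop κ ℓ U u := by
  change _ = x • Submodule.Quotient.mk (1 ⊗ₜ[ℂ] u)
  rw [← Submodule.Quotient.mk_smul, TensorProduct.smul_tmul', smul_eq_mul, mul_one]

lemma ι_smul_vermaTop (x : nonnegPart κ) (u : U) :
    UniversalEnvelopingAlgebra.ι ℂ (x : Affine κ) • vermaTop κ ℓ U u =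
      vermaTop κ ℓ U (nonnegAction κ ℓ U x u) := by
  have := envMap_nonneg_smul_vermaTop κ ℓ U (UniversalEnvelopingAlgebra.ι ℂ x) u
  rwa [envMap_ι, nonnegEnvAction, UniversalEnvelopingAlgebra.lift_ι_apply] at this

lemma nonnegAction_of_mem_plusPart {x : nonnegPart κ} (hx : (x : Affine κ) ∈ plusPart κ) :
    nonnegAction κ ℓ U x = 0 := by
  change LieModule.toEnd ℂ g U (coeff κ 0 x) +
    ((ℓ : ℂ) * centralCoeff κ x) • (1 : Module.End ℂ U) = 0
  rw [coeff_eq_zero_of_mem_plusPart κ hx le_rfl, centralCoeff_eq_zero_of_mem_plusPart κ hx,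
    map_zero, mul_zero, zero_smul, add_zero]

lemma env_induction {L : Type*} [LieRing L] [LieAlgebra ℂ L] {V : Type*} [AddCommGroup V]
    [Module ℂ V] (f f' : UniversalEnvelopingAlgebra ℂ L →ₗ[ℂ] V) (h1 : f 1 = f' 1)
    (h : ∀ x a, f a = f' a → f (UniversalEnvelopingAlgebra.ι ℂ x * a) =
      f' (UniversalEnvelopingAlgebra.ι ℂ x * a)) : f = f' := by
  have := submodule_eq_top_of_ι_mul_mem (LinearMap.eqLocus f f') h1 h
  exact LinearMap.eqLocus_eq_top.1 this

/-- The linear map `x ↦ x • v`. -/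
def smulLin {V : Type*} [AddCommGroup V] [Module ℂ V] [Module (Env κ) V]
    [IsScalarTower ℂ (Env κ) V] (v : V) : Env κ →ₗ[ℂ] V :=
  (LinearMap.toSpanSingleton (Env κ) V v).restrictScalars ℂ

lemma envMap_plus_smul_vermaTop (c : UniversalEnvelopingAlgebra ℂ (plusPart κ)) (u : U) :
    envMap κ (plusPart κ) c • vermaTop κ ℓ U u =
      vermaTop κ ℓ U (augmentation (plusPart κ) c • u) := by
  refine DFunLike.congr_fun (env_induction
    (smulLin κ (vermaTop κ ℓ U u) ∘ₗ (envMap κ (plusPart κ)).toLinearMap)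
    (vermaTop κ ℓ U ∘ₗ (LinearMap.toSpanSingleton ℂ U u) ∘ₗ
      (augmentation (plusPart κ)).toLinearMap) ?_ fun x a ha => ?_) c
  · change envMap κ (plusPart κ) 1 • vermaTop κ ℓ U u =
      vermaTop κ ℓ U (augmentation (plusPart κ) 1 • u)
    rw [map_one, map_one, one_smul, one_smul]
  · replace ha : envMap κ (plusPart κ) a • vermaTop κ ℓ U u =
      vermaTop κ ℓ U (augmentation (plusPart κ) a • u) := ha
    change envMap κ (plusPart κ) (UniversalEnvelopingAlgebra.ι ℂ x * a) • vermaTop κ ℓ U u =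
      vermaTop κ ℓ U (augmentation (plusPart κ) (UniversalEnvelopingAlgebra.ι ℂ x * a) • u)
    have h := ι_smul_vermaTop κ ℓ U ⟨x, plusPart_le_nonnegPart κ x.2⟩
      (augmentation (plusPart κ) a • u)
    rw [nonnegAction_of_mem_plusPart κ ℓ U x.2] at h
    rw [map_mul, map_mul, mul_smul, ha, envMap_ι, augmentation_ι, h, zero_mul, zero_smul]
    rfl

lemma envMap_zero_smul_vermaTop (b : UniversalEnvelopingAlgebra ℂ (zeroPart κ)) (u : U) :
    envMap κ (zeroPart κ) b • vermaTop κ ℓ U u = vermaTop κ ℓ U (zeroEnvAction κ ℓ U b u) := by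
  refine DFunLike.congr_fun (env_induction
    (smulLin κ (vermaTop κ ℓ U u) ∘ₗ (envMap κ (zeroPart κ)).toLinearMap)
    (vermaTop κ ℓ U ∘ₗ (LinearMap.applyₗ u) ∘ₗ (zeroEnvAction κ ℓ U).toLinearMap)
    ?_ fun x a ha => ?_) b
  · change envMap κ (zeroPart κ) 1 • vermaTop κ ℓ U u =
      vermaTop κ ℓ U (zeroEnvAction κ ℓ U 1 u)
    rw [map_one, map_one, one_smul, Module.End.one_apply]
  · replace ha : envMap κ (zeroPart κ) a • vermaTop κ ℓ U u =
      vermaTop κ ℓ U (zeroEnvAction κ ℓ U a u) := ha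
    change envMap κ (zeroPart κ) (UniversalEnvelopingAlgebra.ι ℂ x * a) • vermaTop κ ℓ U u =
      vermaTop κ ℓ U (zeroEnvAction κ ℓ U (UniversalEnvelopingAlgebra.ι ℂ x * a) u)
    have h := ι_smul_vermaTop κ ℓ U ⟨x, zeroPart_le_nonnegPart κ x.2⟩
      (zeroEnvAction κ ℓ U a u)
    rw [map_mul, map_mul, mul_smul, ha, envMap_ι, h, Module.End.mul_apply]
    congr 1
    rw [zeroEnvAction, UniversalEnvelopingAlgebra.lift_ι_apply]
    rfl

/-- The additive map `x ⊗ u ↦ ρ(x) (τ u)` for a ring homomorphism `ρ` on `U(ĝ)`, as a semilinear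
map. -/
def tensorSemilinear {S : Type*} [Ring S] {N : Type*} [AddCommGroup N] [Module ℂ N] [Module S N]
    [Algebra ℂ S] [IsScalarTower ℂ S N] (ρ : Env κ →ₐ[ℂ] S) (τ : U →ₗ[ℂ] N) :
    (Env κ ⊗[ℂ] U) →ₛₗ[(ρ : Env κ →+* S)] N where
  toFun := TensorProduct.lift (LinearMap.mk₂ ℂ (fun x u => ρ x • τ u)
    (fun x y u => by rw [map_add, add_smul])
    (fun r x u => by rw [map_smul, smul_assoc])
    (fun x u u' => by rw [map_add, smul_add])
    (fun r x u => by rw [map_smul, algebra_compatible_smul S r, ← mul_smul,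
      ← Algebra.commutes, mul_smul, ← algebra_compatible_smul S r]))
  map_add' x y := map_add _ x y
  map_smul' x z := by
    induction z with
    | zero => simp
    | add z z' h h' => rw [smul_add, map_add, h, h', map_add, smul_add]
    | tmul y u =>
      rw [TensorProduct.smul_tmul', TensorProduct.lift.tmul, TensorProduct.lift.tmul,
        LinearMap.mk₂_apply, LinearMap.mk₂_apply, smul_eq_mul, map_mul, mul_smul]
      rfl

/-- The semilinear map on the generalized Verma module induced by a linear map on `U` which is
compatible with the action of `ĝ₊ ⊕ ĝ₀`. -/
def vermaLift {S : Type*} [Ring S] {N : Type*} [AddCommGroup N] [Module ℂ N] [Module S N]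
    [Algebra ℂ S] [IsScalarTower ℂ S N] (ρ : Env κ →ₐ[ℂ] S) (τ : U →ₗ[ℂ] N)
    (h : ∀ (x : nonnegPart κ) u, ρ (UniversalEnvelopingAlgebra.ι ℂ (x : Affine κ)) • τ u =
      τ (nonnegAction κ ℓ U x u)) : Verma κ ℓ U →ₛₗ[(ρ : Env κ →+* S)] N :=
  Submodule.liftQ _ (tensorSemilinear κ U ρ τ) (by
    refine Submodule.span_le.2 ?_
    rintro _ ⟨b, u, rfl⟩
    rw [SetLike.mem_coe, LinearMap.mem_ker, map_sub, sub_eq_zero]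
    have h' : ∀ x u, tensorSemilinear κ U ρ τ (x ⊗ₜ u) = ρ x • τ u := fun _ _ => rfl
    rw [h', h', map_one, one_smul]
    let f : UniversalEnvelopingAlgebra ℂ (nonnegPart κ) →ₗ[ℂ] N :=
      (LinearMap.toSpanSingleton S N (τ u)).restrictScalars ℂ ∘ₗ
        (ρ.comp (envMap κ (nonnegPart κ))).toLinearMap
    refine DFunLike.congr_fun (env_induction f
      (τ ∘ₗ (LinearMap.applyₗ u) ∘ₗ (nonnegEnvAction κ ℓ U).toLinearMap) ?_ fun x a ha => ?_) b
    · change ρ (envMap κ _ 1) • τ u = τ (nonnegEnvAction κ ℓ U 1 u)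
      rw [map_one, map_one, map_one, one_smul, Module.End.one_apply]
    · replace ha : ρ (envMap κ _ a) • τ u = τ (nonnegEnvAction κ ℓ U a u) := ha
      change ρ (envMap κ _ (_ * a)) • τ u = τ (nonnegEnvAction κ ℓ U (_ * a) u)
      rw [map_mul, map_mul, map_mul, mul_smul, ha, envMap_ι, h, Module.End.mul_apply]
      congr 1
      rw [nonnegEnvAction, UniversalEnvelopingAlgebra.lift_ι_apply])

lemma vermaLift_vermaTop {S : Type*} [Ring S] {N : Type*} [AddCommGroup N] [Module ℂ N]
    [Module S N] [Algebra ℂ S] [IsScalarTower ℂ S N] (ρ : Env κ →ₐ[ℂ] S) (τ : U →ₗ[ℂ] N)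
    (h : ∀ (x : nonnegPart κ) u, ρ (UniversalEnvelopingAlgebra.ι ℂ (x : Affine κ)) • τ u =
      τ (nonnegAction κ ℓ U x u)) (u : U) :
    vermaLift κ ℓ U ρ τ h (vermaTop κ ℓ U u) = τ u := by
  change ρ 1 • τ u = τ u
  rw [map_one, one_smul]

/-- The action of `ĝ` on `U(ĝ₋) ⊗ U`. -/
def minusTensorAction :
    Env κ →ₐ[ℂ] Module.End ℂ (UniversalEnvelopingAlgebra ℂ (minusPart κ) ⊗[ℂ] U) :=
  UniversalEnvelopingAlgebra.lift ℂ (inducedHom (minusPart κ) (nonnegPart κ) (nonnegAction κ ℓ U)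
    (Submodule.projectionOnto _ _ (isCompl_minusPart_nonnegPart κ))
    (Submodule.projectionOnto _ _ (isCompl_minusPart_nonnegPart κ).symm)
    (fun y => Submodule.projectionOnto_apply_left _ y)
    (fun y => Submodule.projectionOnto_apply_right _ y)
    (fun y => Submodule.projectionOnto_apply_left _ y)
    (fun y => Submodule.projectionOnto_apply_right _ y)
    (fun z => Submodule.projection_add_projection_eq_self (isCompl_minusPart_nonnegPart κ) z))

lemma minusTensorAction_minus (y : minusPart κ)
    (w : UniversalEnvelopingAlgebra ℂ (minusPart κ) ⊗[ℂ] U) :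
    minusTensorAction κ ℓ U (UniversalEnvelopingAlgebra.ι ℂ (y : Affine κ)) w =
      UniversalEnvelopingAlgebra.ι ℂ y • w := by
  rw [minusTensorAction, UniversalEnvelopingAlgebra.lift_ι_apply]
  exact inducedAction_coe _ _ _ _ _ (fun y => Submodule.projectionOnto_apply_left _ y)
    (fun y => Submodule.projectionOnto_apply_right _ y) y w

lemma minusTensorAction_envMap (x : UniversalEnvelopingAlgebra ℂ (minusPart κ))
    (w : UniversalEnvelopingAlgebra ℂ (minusPart κ) ⊗[ℂ] U) :
    minusTensorAction κ ℓ U (envMap κ (minusPart κ) x) w = x • w := by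
  have : (minusTensorAction κ ℓ U).comp (envMap κ (minusPart κ)) =
      Algebra.lsmul ℂ ℂ (UniversalEnvelopingAlgebra ℂ (minusPart κ) ⊗[ℂ] U) := by
    apply UniversalEnvelopingAlgebra.hom_ext
    refine LieHom.ext fun y => LinearMap.ext fun w => ?_
    change minusTensorAction κ ℓ U (envMap κ (minusPart κ) (UniversalEnvelopingAlgebra.ι ℂ y)) w =
      UniversalEnvelopingAlgebra.ι ℂ y • w
    rw [envMap_ι, minusTensorAction_minus]
  exact DFunLike.congr_fun (DFunLike.congr_fun this x) w

lemma minusTensorAction_nonneg (x : nonnegPart κ) (u : U) :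
    minusTensorAction κ ℓ U (UniversalEnvelopingAlgebra.ι ℂ (x : Affine κ)) (1 ⊗ₜ u) =
      1 ⊗ₜ nonnegAction κ ℓ U x u := by
  rw [minusTensorAction, UniversalEnvelopingAlgebra.lift_ι_apply]
  refine (inducedAction_one_tmul _ _ _ _ _ _ u).trans ?_
  have h1 : Submodule.projectionOnto _ _ (isCompl_minusPart_nonnegPart κ) (x : Affine κ) = 0 :=
    Submodule.projectionOnto_apply_right _ x
  have h2 : Submodule.projectionOnto _ _ (isCompl_minusPart_nonnegPart κ).symm (x : Affine κ) = x :=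
    Submodule.projectionOnto_apply_left _ x
  erw [h1, h2]
  rw [map_zero, TensorProduct.zero_tmul, add_zero]

/-- The map `V_ĝ(ℓ, U) → U(ĝ₋) ⊗ U`. -/
def vermaToTensor : Verma κ ℓ U →ₛₗ[(minusTensorAction κ ℓ U : Env κ →+*
      Module.End ℂ (UniversalEnvelopingAlgebra ℂ (minusPart κ) ⊗[ℂ] U))]
    UniversalEnvelopingAlgebra ℂ (minusPart κ) ⊗[ℂ] U :=
  vermaLift κ ℓ U (minusTensorAction κ ℓ U)
    (TensorProduct.mk ℂ (UniversalEnvelopingAlgebra ℂ (minusPart κ)) U 1)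
    (fun x u => minusTensorAction_nonneg κ ℓ U x u)

lemma vermaToTensor_vermaTop (u : U) : vermaToTensor κ ℓ U (vermaTop κ ℓ U u) = 1 ⊗ₜ u :=
  vermaLift_vermaTop κ ℓ U _ _ _ u

lemma vermaToTensor_smul (x : Env κ) (v : Verma κ ℓ U) : vermaToTensor κ ℓ U (x • v) =
    minusTensorAction κ ℓ U x (vermaToTensor κ ℓ U v) :=
  LinearMap.map_smulₛₗ (vermaToTensor κ ℓ U) x v

/-- The map `U(ĝ₋) ⊗ U → V_ĝ(ℓ, U)`. -/
def tensorToVerma : UniversalEnvelopingAlgebra ℂ (minusPart κ) ⊗[ℂ] U →ₗ[ℂ] Verma κ ℓ U :=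
  TensorProduct.lift (LinearMap.mk₂ ℂ
    (fun x u => envMap κ (minusPart κ) x • vermaTop κ ℓ U u)
    (fun x y u => by rw [map_add, add_smul])
    (fun r x u => by rw [map_smul, smul_assoc])
    (fun x u u' => by rw [map_add, smul_add])
    (fun r x u => by rw [map_smul, smul_comm]))

lemma tensorToVerma_tmul (x : UniversalEnvelopingAlgebra ℂ (minusPart κ)) (u : U) :
    tensorToVerma κ ℓ U (x ⊗ₜ u) = envMap κ (minusPart κ) x • vermaTop κ ℓ U u := rfl

/-- This one-sided inverse is the independence half of a PBW statement, obtained from the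
constructed action on the tensor product. -/
lemma vermaToTensor_tensorToVerma (w : UniversalEnvelopingAlgebra ℂ (minusPart κ) ⊗[ℂ] U) :
    vermaToTensor κ ℓ U (tensorToVerma κ ℓ U w) = w := by
  induction w with
  | zero => rw [map_zero, map_zero]
  | add w w' h h' => rw [map_add, map_add, h, h']
  | tmul x u =>
    rw [tensorToVerma_tmul, vermaToTensor_smul, vermaToTensor_vermaTop]
    rw [minusTensorAction_envMap, TensorProduct.smul_tmul', smul_eq_mul, mul_one]

/-- In the tensor model, `u` is recovered from `1 ⊗ u` by the augmentation of `U(ĝ₋)`. -/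
lemma vermaTop_injective : Function.Injective (vermaTop κ ℓ U) := by
  intro u u' h
  have h1 := congrArg (vermaToTensor κ ℓ U) h
  rw [vermaToTensor_vermaTop, vermaToTensor_vermaTop] at h1
  have h2 := congrArg ((TensorProduct.lid ℂ U).toLinearMap ∘ₗ
    LinearMap.rTensor U (augmentation (minusPart κ)).toLinearMap) h1
  simpa using h2

/-- The endomorphism of `V_ĝ(ℓ, U)` acting as `2^{-n}` on the space of weight `n`, as a
semilinear map. -/
def vermaScaleₛₗ : Verma κ ℓ U →ₛₗ[(scaleEnv κ : Env κ →+* Env κ)] Verma κ ℓ U :=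
  vermaLift κ ℓ U (scaleEnv κ) (vermaTop κ ℓ U) (by
    intro x u
    rw [scaleEnv_ι]
    -- Scaling fixes `ĝ₀` and multiplies positive modes by scalars, so it changes `x` only by an
    -- element of `ĝ₊`, which kills `1 ⊗ U`.
    have hx : (scale κ x - x : Affine κ) ∈ plusPart κ := by
      have : (nonnegPart κ).toSubmodule ≤
          (plusPart κ).toSubmodule.comap ((scale κ).toLinearMap - LinearMap.id) := by
        refine Submodule.span_le.2 ?_
        rintro _ (⟨n, hn, a, rfl⟩ | rfl)
        · change scale κ (mode κ n a) - mode κ n a ∈ plusPart κ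
          rw [scale_mode]
          rcases hn.lt_or_eq with hn | rfl
          · exact sub_mem (Submodule.smul_mem _ _ (mode_mem_plusPart κ hn a))
              (mode_mem_plusPart κ hn a)
          · rw [zpow_zero, one_smul, sub_self]
            exact zero_mem _
        · change scale κ (central κ) - central κ ∈ plusPart κ
          rw [scale_central, sub_self]
          exact zero_mem _
      exact this x.2
    have h1 := ι_smul_vermaTop κ ℓ U ⟨_, plusPart_le_nonnegPart κ hx⟩ u
    rw [nonnegAction_of_mem_plusPart κ ℓ U hx] at h1
    rw [← ι_smul_vermaTop, ← sub_eq_zero, ← sub_smul, ← map_sub]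
    simpa using h1)

end VermaModules

/-! ### Gradings by eigenspaces -/

section EigenGradings

/-- By the modular law: with `a i` and the other `e j` filling everything, `e i` has no room beyond
`a i`. -/
lemma eq_of_le_of_iSupIndep {α ι : Type*} [CompleteLattice α] [IsModularLattice α] {a e : ι → α}
    (hle : ∀ i, a i ≤ e i) (hind : iSupIndep e) (htop : ⨆ i, a i = ⊤) (i : ι) : a i = e i := by
  refine le_antisymm (hle i) ?_
  have h1 : a i ⊔ ⨆ j ≠ i, e j = ⊤ := by
    rw [eq_top_iff, ← htop]
    refine iSup_le fun j => ?_
    rcases eq_or_ne j i with rfl | hj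
    · exact le_sup_left
    · exact le_sup_of_le_right ((hle j).trans (le_iSup₂_of_le j hj le_rfl))
  refine le_of_eq ?_
  calc e i = (a i ⊔ ⨆ j ≠ i, e j) ⊓ e i := by rw [h1, top_inf_eq]
    _ = a i ⊔ (⨆ j ≠ i, e j) ⊓ e i := by rw [sup_inf_assoc_of_le _ (hle i)]
    _ = a i := by rw [inf_comm, (hind i).eq_bot, sup_bot_eq]

variable {V : Type v} [AddCommGroup V] [Module ℂ V] {T : Module.End ℂ V} {W : ℤ → Submodule ℂ V}

lemma two_zpow_neg_injective : Function.Injective fun n : ℤ => (2 : ℂ) ^ (-n) := by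
  intro m n h
  have h' : ((2 : ℝ) ^ (-m)) = (2 : ℝ) ^ (-n) := by
    have : (((2 : ℝ) ^ (-m) : ℝ) : ℂ) = ((2 : ℝ) ^ (-n) : ℝ) := by push_cast; exact h
    exact_mod_cast this
  have := zpow_right_injective₀ (a := (2 : ℝ)) (by norm_num) (by norm_num) h'
  omega

lemma iSupIndep_eigenspace (T : Module.End ℂ V) :
    iSupIndep fun n : ℤ => T.eigenspace ((2 : ℂ) ^ (-n)) :=
  T.eigenspaces_iSupIndep.comp two_zpow_neg_injective

/-- Invariant subspaces contain the eigencomponents of their elements, by eliminating one eigenvalue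
at a time. -/
lemma eq_iSup_inf_of_invariant (hW : ∀ n, W n ≤ T.eigenspace ((2 : ℂ) ^ (-n)))
    (htop : ⨆ n, W n = ⊤) {N : Submodule ℂ V} (hN : ∀ v ∈ N, T v ∈ N) : N = ⨆ n, N ⊓ W n := by
  classical
  refine le_antisymm (fun v hv => ?_) (iSup_le fun n => inf_le_left)
  have key : ∀ (s : Finset ℤ) (w : ℤ → V), (∀ n, w n ∈ W n) → ∑ n ∈ s, w n ∈ N →
      ∀ n ∈ s, w n ∈ N := by
    intro s
    induction s using Finset.induction_on with
    | empty => simp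
    | insert m s hm ih =>
      intro w hw hs
      have hT : ∀ n, T (w n) = (2 : ℂ) ^ (-n) • w n := fun n =>
        Module.End.mem_eigenspace_iff.1 (hW n (hw n))
      -- Subtracting `2 ^ (-m)` times the sum from its image under `T` removes the component `m` and
      -- rescales the others by nonzero factors.
      have h1 : ∑ n ∈ s, ((2 : ℂ) ^ (-n) - (2 : ℂ) ^ (-m)) • w n ∈ N := by
        have h2 := N.sub_mem (hN _ hs) (N.smul_mem ((2 : ℂ) ^ (-m)) hs)
        rw [map_sum, Finset.smul_sum, ← Finset.sum_sub_distrib, Finset.sum_insert hm, hT,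
          sub_self, zero_add] at h2
        convert h2 using 2 with n hn
        rw [hT, sub_smul]
      have h3 := ih (fun n => ((2 : ℂ) ^ (-n) - (2 : ℂ) ^ (-m)) • w n)
        (fun n => (W n).smul_mem _ (hw n)) h1
      have h4 : ∀ n ∈ s, w n ∈ N := fun n hn => by
        have hne : (2 : ℂ) ^ (-n) - (2 : ℂ) ^ (-m) ≠ 0 := by
          rw [sub_ne_zero]
          intro h
          exact hm (two_zpow_neg_injective h ▸ hn)
        exact (N.smul_mem_iff hne).1 (h3 n hn)
      intro n hn
      rcases Finset.mem_insert.1 hn with rfl | hn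
      · rw [Finset.sum_insert hm] at hs
        exact (N.add_mem_iff_left (N.sum_mem h4)).1 hs
      · exact h4 n hn
  obtain ⟨f, hf, rfl⟩ := (Submodule.mem_iSup_iff_exists_finsupp W v).1 (htop ▸ Submodule.mem_top)
  refine Submodule.sum_mem _ fun n hn => Submodule.mem_iSup_of_mem n ⟨?_, hf n⟩
  exact key f.support f hf hv n hn

end EigenGradings

/-! ### Transport of scalar lifts and finite generation -/

section IntegralForms

variable {V : Type u} [AddCommGroup V] [Module ℂ V] {V' : Type v} [AddCommGroup V'] [Module ℂ V']

lemma HasScalarLifts.mono {M N : AddSubgroup V} (h : M ≤ N) (hN : HasScalarLifts N) :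
    HasScalarLifts M := fun f => by
  obtain ⟨F, hF⟩ := hN f
  exact ⟨F, fun c m hm => hF c m (h hm)⟩

lemma mem_closure_of_mem_closure₂ {X Y Z : Type*} [AddCommGroup X] [AddCommGroup Y]
    [AddCommGroup Z] (β : X →+ Y →+ Z) {s : Set X} {t : Set Y} {x : X} {y : Y}
    (hx : x ∈ AddSubgroup.closure s) (hy : y ∈ AddSubgroup.closure t) :
    β x y ∈ AddSubgroup.closure (Set.image2 (fun x y => β x y) s t) := by
  set C := AddSubgroup.closure (Set.image2 (fun x y => β x y) s t) with hC
  have h1 : ∀ x ∈ s, β x y ∈ C := fun x hx =>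
    (AddSubgroup.closure_le (C.comap (β x))).2
      (fun y hy => AddSubgroup.subset_closure ⟨x, hx, y, hy, rfl⟩) hy
  exact (AddSubgroup.closure_le (C.comap (β.flip y))).2 h1 hx

lemma fg_closure_image2 {X Y Z : Type*} [AddCommGroup X] [AddCommGroup Y]
    [AddCommGroup Z] (β : X →+ Y →+ Z) {M : AddSubgroup X} {N : AddSubgroup Y} (hM : M.FG)
    (hN : N.FG) : (AddSubgroup.closure (Set.image2 (fun x y => β x y) (M : Set X) N)).FG := by
  classical
  obtain ⟨s, rfl⟩ := hM
  obtain ⟨t, rfl⟩ := hN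
  refine fg_of_le (N := AddSubgroup.closure (Set.image2 (fun x y => β x y) (s : Set X) t)) ?_
    (show AddSubgroup.FG _ from ⟨Finset.image₂ (fun x y => β x y) s t, by
      rw [Finset.coe_image₂]⟩)
  rw [AddSubgroup.closure_le]
  rintro _ ⟨x, hx, y, hy, rfl⟩
  exact mem_closure_of_mem_closure₂ β hx hy

/-- A lift that preserves the kernel of `π` induces an additive map on the quotient. -/
lemma HasScalarLifts.map {M : AddSubgroup V} (π : V →ₗ[ℂ] V') (hπ : Function.Surjective π)
    (h : ∀ f : ℂ →ₗ[ℚ] ℚ, ∃ F : V →+ V, (∀ c : ℂ, ∀ m ∈ M, F (c • m) = (f c : ℂ) • m) ∧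
      ∀ v, π v = 0 → π (F v) = 0) : HasScalarLifts (M.map (π : V →+ V')) := by
  intro f
  obtain ⟨F, hF, hker⟩ := h f
  let G : V' →+ V' := (π : V →+ V').liftOfSurjective hπ ⟨(π : V →+ V').comp F, hker⟩
  have hG : ∀ v, G (π v) = π (F v) := fun v =>
    (π : V →+ V').liftOfRightInverse_comp_apply _ _ ⟨(π : V →+ V').comp F, hker⟩ v
  refine ⟨G, ?_⟩
  rintro c _ ⟨m, hm, rfl⟩
  change G (c • π m) = (f c : ℂ) • π m
  rw [← map_smul, hG, hF c m hm, map_smul]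

end IntegralForms

/-! ### The integral form of the Verma module -/

section VermaStructure

attribute [local instance 100] LieRing.ofAssociativeRing

variable {g : Type u} [LieRing g] [LieAlgebra ℂ g] {κ : InvariantForm g}

lemma smul_mem_generated (A : Subring (Env κ)) {W : Type v} [AddCommGroup W] [Module (Env κ) W]
    (T : Set W) {x : Env κ} (hx : x ∈ A) {w : W} (hw : w ∈ generated A T) :
    x • w ∈ generated A T := by
  induction hw using AddSubgroup.closure_induction with
  | mem w hw =>
    obtain ⟨y, hy, t, ht, rfl⟩ := hw
    exact AddSubgroup.subset_closure ⟨x * y, A.mul_mem hx hy, t, ht, (mul_smul x y t).symm⟩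
  | zero => rw [smul_zero]; exact AddSubgroup.zero_mem _
  | add v w _ _ h h' => rw [smul_add]; exact AddSubgroup.add_mem _ h h'
  | neg w _ h => rw [smul_neg]; exact AddSubgroup.neg_mem _ h

lemma IntegralEnvelope.span_whole (A : IntegralEnvelope κ) :
    Submodule.span ℂ (A.whole : Set (Env κ)) = ⊤ := A.whole_form.span_eq_top

lemma IntegralEnvelope.envMap_minus_mem (A : IntegralEnvelope κ)
    {a : UniversalEnvelopingAlgebra ℂ (minusPart κ)} (ha : a ∈ A.minus) :
    envMap κ (minusPart κ) a ∈ A.whole := by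
  change envMap κ (minusPart κ) a ∈ A.whole.toAddSubgroup
  rw [A.decomposition]
  exact AddSubgroup.subset_closure ⟨a, ha, 1, one_mem _, 1, one_mem _, by simp⟩

variable (A : IntegralEnvelope κ) (ℓ : ℤ) {U : Type v} [AddCommGroup U] [Module ℂ U]
  [LieRingModule g U] [LieModule ℂ g U] {UZ : AddSubgroup U}

/-- The part of `U_ℤ(ĝ) U_ℤ` of weight `n`. -/
def generatedPiece (UZ : AddSubgroup U) (n : ℤ) : AddSubgroup (Verma κ ℓ U) :=
  AddSubgroup.closure {w | ∃ a ∈ A.minus, a ∈ envDegree κ (minusPart κ) (-n) ∧ ∃ u ∈ UZ,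
    w = envMap κ (minusPart κ) a • vermaTop κ ℓ U u}

lemma minus_smul_mem_iSup {a : UniversalEnvelopingAlgebra ℂ (minusPart κ)} (ha : a ∈ A.minus)
    {u : U} (hu : u ∈ UZ) :
    envMap κ (minusPart κ) a • vermaTop κ ℓ U u ∈ ⨆ n, generatedPiece A ℓ UZ n := by
  have ha' : a ∈ ⨆ n, A.minus.toAddSubgroup ⊓ (envDegree κ (minusPart κ) n).toAddSubgroup :=
    A.minus_graded.eq_iSup ▸ (show a ∈ A.minus.toAddSubgroup from ha)
  clear ha
  induction ha' using AddSubgroup.iSup_induction' with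
  | hp n x hx =>
    refine AddSubgroup.mem_iSup_of_mem (-n) (AddSubgroup.subset_closure ⟨x, hx.1, ?_, u, hu, rfl⟩)
    rw [neg_neg]
    exact hx.2
  | h1 => rw [map_zero, zero_smul]; exact AddSubgroup.zero_mem _
  | hadd x y _ _ hx hy => rw [map_add, add_smul]; exact AddSubgroup.add_mem _ hx hy

/-- In a product `a b c` applied to `1 ⊗ u`, the factor `c` acts by an integer and `b` preserves
`U_ℤ`. Only `a` remains, and it splits into homogeneous parts inside `U_ℤ(ĝ₋)`. -/
lemma generated_eq_iSup
    (hinv : ∀ b ∈ A.zero, ∀ u ∈ UZ, zeroEnvAction κ ℓ U b u ∈ UZ) :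
    generated A.whole (vermaTop κ ℓ U '' UZ) = ⨆ n, generatedPiece A ℓ UZ n := by
  refine le_antisymm ((AddSubgroup.closure_le _).2 ?_) (iSup_le fun n =>
    (AddSubgroup.closure_le _).2 ?_)
  · rintro _ ⟨x, hx, _, ⟨u, hu, rfl⟩, rfl⟩
    replace hx : x ∈ A.whole.toAddSubgroup := hx
    rw [A.decomposition] at hx
    induction hx using AddSubgroup.closure_induction with
    | mem x hx =>
      obtain ⟨a, ha, b, hb, c, hc, rfl⟩ := hx
      obtain ⟨m, hm⟩ := A.exists_int_augmentation hc
      rw [mul_smul, mul_smul, envMap_plus_smul_vermaTop, hm, Int.cast_smul_eq_zsmul,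
        envMap_zero_smul_vermaTop]
      exact minus_smul_mem_iSup A ℓ ha (hinv b hb _ (UZ.zsmul_mem hu m))
    | zero => rw [zero_smul]; exact AddSubgroup.zero_mem _
    | add v w _ _ h h' => rw [add_smul]; exact AddSubgroup.add_mem _ h h'
    | neg w _ h => rw [neg_smul]; exact AddSubgroup.neg_mem _ h
  · rintro _ ⟨a, ha, -, u, hu, rfl⟩
    exact AddSubgroup.subset_closure ⟨_, A.envMap_minus_mem ha, _, ⟨u, hu, rfl⟩, rfl⟩

lemma submodule_eq_top_of_smul_vermaTop_mem (S : Submodule ℂ (Verma κ ℓ U))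
    (h : ∀ (x : Env κ) u, x • vermaTop κ ℓ U u ∈ S) : S = ⊤ := by
  rw [eq_top_iff]
  intro v _
  obtain ⟨z, rfl⟩ := Submodule.Quotient.mk_surjective _ v
  induction z with
  | zero => exact S.zero_mem
  | add z z' h h' => exact S.add_mem (h trivial) (h' trivial)
  | tmul x u => rw [mk_tmul]; exact h x u

lemma span_generated (hUZ : IsIntegralForm UZ) :
    Submodule.span ℂ (generated A.whole (vermaTop κ ℓ U '' UZ) : Set (Verma κ ℓ U)) = ⊤ := by
  set S := Submodule.span ℂ (generated A.whole (vermaTop κ ℓ U '' UZ) : Set (Verma κ ℓ U))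
  refine submodule_eq_top_of_smul_vermaTop_mem ℓ S fun x u => ?_
  have h1 : ∀ u ∈ UZ, ∀ x : Env κ, x • vermaTop κ ℓ U u ∈ S := fun u hu x => by
    have : Submodule.span ℂ (A.whole : Set (Env κ)) ≤ S.comap (smulLin κ (vermaTop κ ℓ U u)) :=
      Submodule.span_le.2 fun y hy =>
        Submodule.subset_span (AddSubgroup.subset_closure ⟨y, hy, _, ⟨u, hu, rfl⟩, rfl⟩)
    rw [A.span_whole] at this
    exact this (Submodule.mem_top : x ∈ ⊤)
  have h2 : Submodule.span ℂ (UZ : Set U) ≤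
      S.comap (Module.toModuleEnd ℂ (S := Env κ) (Verma κ ℓ U) x ∘ₗ vermaTop κ ℓ U) :=
    Submodule.span_le.2 fun u hu => h1 u hu x
  rw [hUZ.span_eq_top] at h2
  exact h2 (Submodule.mem_top : u ∈ ⊤)

lemma generatedPiece_le (n : ℤ) :
    generatedPiece A ℓ UZ n ≤ (vermaGrading κ ℓ U n).toAddSubgroup := by
  refine (AddSubgroup.closure_le _).2 ?_
  rintro _ ⟨a, -, ha, u, -, rfl⟩
  exact Submodule.subset_span ⟨a, ha, u, rfl⟩

section

variable (κ)

/-- A semilinear map over a `ℂ`-algebra homomorphism, as a `ℂ`-linear map. -/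
def linearOfSemilinear {S : Type*} [Ring S] [Algebra ℂ S] {X Y : Type*} [AddCommGroup X]
    [Module ℂ X] [Module (Env κ) X] [IsScalarTower ℂ (Env κ) X] [AddCommGroup Y] [Module ℂ Y]
    [Module S Y] [IsScalarTower ℂ S Y] {ρ : Env κ →ₐ[ℂ] S} (f : X →ₛₗ[(ρ : Env κ →+* S)] Y) :
    X →ₗ[ℂ] Y where
  toFun := f
  map_add' := map_add f
  map_smul' r x := by
    rw [algebra_compatible_smul (Env κ) r x, LinearMap.map_smulₛₗ, RingHom.id_apply,
      algebra_compatible_smul S r (f x)]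
    congr 1
    exact ρ.commutes r

variable (U)

/-- The endomorphism of `V_ĝ(ℓ, U)` acting as `2^{-n}` on the space of weight `n`. -/
def vermaScale : Module.End ℂ (Verma κ ℓ U) := linearOfSemilinear κ (vermaScaleₛₗ κ ℓ U)

variable {U}

lemma vermaScale_smul (x : Env κ) (v : Verma κ ℓ U) :
    vermaScale κ ℓ U (x • v) = scaleEnv κ x • vermaScale κ ℓ U v :=
  LinearMap.map_smulₛₗ (vermaScaleₛₗ κ ℓ U) x v

lemma vermaScale_vermaTop (u : U) :
    vermaScale κ ℓ U (vermaTop κ ℓ U u) = vermaTop κ ℓ U u := by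
  change vermaScaleₛₗ κ ℓ U (vermaTop κ ℓ U u) = vermaTop κ ℓ U u
  rw [vermaScaleₛₗ, vermaLift_vermaTop]

lemma vermaGrading_le_eigenspace (n : ℤ) :
    vermaGrading κ ℓ U n ≤ (vermaScale κ ℓ U).eigenspace ((2 : ℂ) ^ (-n)) := by
  refine Submodule.span_le.2 ?_
  rintro _ ⟨x, hx, u, rfl⟩
  rw [SetLike.mem_coe, Module.End.mem_eigenspace_iff, vermaScale_smul, vermaScale_vermaTop,
    scaleEnv_envMap κ hx, smul_assoc]

lemma iSupIndep_vermaGrading : iSupIndep (vermaGrading κ ℓ U) :=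
  (iSupIndep_eigenspace (vermaScale κ ℓ U)).mono (vermaGrading_le_eigenspace κ ℓ)

end

lemma iSup_span_generatedPiece (hUZ : IsIntegralForm UZ)
    (hinv : ∀ b ∈ A.zero, ∀ u ∈ UZ, zeroEnvAction κ ℓ U b u ∈ UZ) :
    ⨆ n, Submodule.span ℂ (generatedPiece A ℓ UZ n : Set (Verma κ ℓ U)) = ⊤ := by
  rw [eq_top_iff, ← span_generated A ℓ hUZ, Submodule.span_le, generated_eq_iSup A ℓ hinv]
  have : ⨆ n, generatedPiece A ℓ UZ n ≤
      (⨆ n, Submodule.span ℂ (generatedPiece A ℓ UZ n : Set (Verma κ ℓ U))).toAddSubgroup :=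
    iSup_le fun n x hx => Submodule.mem_iSup_of_mem n (Submodule.subset_span hx)
  exact this

/-- The spans of the pieces exhaust the module and sit inside independent eigenspaces, so nothing is
lost. The weight space lies between the two and equals both. -/
lemma span_generatedPiece_eq_eigenspace (hUZ : IsIntegralForm UZ)
    (hinv : ∀ b ∈ A.zero, ∀ u ∈ UZ, zeroEnvAction κ ℓ U b u ∈ UZ) (n : ℤ) :
    Submodule.span ℂ (generatedPiece A ℓ UZ n : Set (Verma κ ℓ U)) =
      (vermaScale κ ℓ U).eigenspace ((2 : ℂ) ^ (-n)) :=
  eq_of_le_of_iSupIndep (fun n => (Submodule.span_le.2 (generatedPiece_le A ℓ n)).trans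
    (vermaGrading_le_eigenspace κ ℓ n)) (iSupIndep_eigenspace _)
    (iSup_span_generatedPiece A ℓ hUZ hinv) n

lemma span_generatedPiece (hUZ : IsIntegralForm UZ)
    (hinv : ∀ b ∈ A.zero, ∀ u ∈ UZ, zeroEnvAction κ ℓ U b u ∈ UZ) (n : ℤ) :
    Submodule.span ℂ (generatedPiece A ℓ UZ n : Set (Verma κ ℓ U)) = vermaGrading κ ℓ U n :=
  le_antisymm (Submodule.span_le.2 (generatedPiece_le A ℓ n))
    ((vermaGrading_le_eigenspace κ ℓ n).trans
      (span_generatedPiece_eq_eigenspace A ℓ hUZ hinv n).ge)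

lemma vermaGrading_eq_eigenspace (hUZ : IsIntegralForm UZ)
    (hinv : ∀ b ∈ A.zero, ∀ u ∈ UZ, zeroEnvAction κ ℓ U b u ∈ UZ) (n : ℤ) :
    vermaGrading κ ℓ U n = (vermaScale κ ℓ U).eigenspace ((2 : ℂ) ^ (-n)) :=
  (span_generatedPiece A ℓ hUZ hinv n).symm.trans
    (span_generatedPiece_eq_eigenspace A ℓ hUZ hinv n)

lemma iSup_vermaGrading (hUZ : IsIntegralForm UZ)
    (hinv : ∀ b ∈ A.zero, ∀ u ∈ UZ, zeroEnvAction κ ℓ U b u ∈ UZ) : ⨆ n, vermaGrading κ ℓ U n = ⊤ := by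
  rw [← iSup_span_generatedPiece A ℓ hUZ hinv]
  exact iSup_congr fun n => (span_generatedPiece A ℓ hUZ hinv n).symm

/-- Surjectivity comes from the integral triangular decomposition, which shows that the weight
spaces span. -/
lemma tensorToVerma_bijective (hUZ : IsIntegralForm UZ)
    (hinv : ∀ b ∈ A.zero, ∀ u ∈ UZ, zeroEnvAction κ ℓ U b u ∈ UZ) : Function.Bijective (tensorToVerma κ ℓ U) := by
  refine ⟨Function.LeftInverse.injective (vermaToTensor_tensorToVerma κ ℓ U),
    LinearMap.range_eq_top.1 ?_⟩
  rw [eq_top_iff, ← iSup_vermaGrading A ℓ hUZ hinv]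
  refine iSup_le fun n => Submodule.span_le.2 ?_
  rintro _ ⟨x, -, u, rfl⟩
  exact ⟨x ⊗ₜ u, rfl⟩

/-- Products of basis vectors of `U_ℤ(ĝ₋)` and `U_ℤ` form a complex basis of the Verma module.
Containment in its `ℤ`-span is enough. -/
lemma hasScalarLifts_generated (hUZ : IsIntegralForm UZ)
    (hinv : ∀ b ∈ A.zero, ∀ u ∈ UZ, zeroEnvAction κ ℓ U b u ∈ UZ) :
    HasScalarLifts (generated A.whole (vermaTop κ ℓ U '' UZ)) := by
  obtain ⟨ι, b, hb⟩ := A.minus_form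
  obtain ⟨ι', b', hb'⟩ := id hUZ
  let e := LinearEquiv.ofBijective _ (tensorToVerma_bijective A ℓ hUZ hinv)
  refine (hasScalarLifts_closure_range ((b.tensorProduct b').map e)).mono ?_
  rw [generated_eq_iSup A ℓ hinv]
  refine iSup_le fun n => (AddSubgroup.closure_le _).2 ?_
  rintro _ ⟨a, ha, -, u, hu, rfl⟩
  replace ha : a ∈ A.minus.toAddSubgroup := ha
  rw [hb] at ha
  rw [hb'] at hu
  let β : UniversalEnvelopingAlgebra ℂ (minusPart κ) →+ U →+ Verma κ ℓ U :=
    AddMonoidHom.mk' (fun a => AddMonoidHom.mk' (fun u => tensorToVerma κ ℓ U (a ⊗ₜ u))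
      fun u u' => by rw [TensorProduct.tmul_add, map_add])
      fun a a' => by ext u; simp [TensorProduct.add_tmul]
  refine AddSubgroup.closure_mono ?_ (mem_closure_of_mem_closure₂ β ha hu)
  rintro _ ⟨_, ⟨i, rfl⟩, _, ⟨j, rfl⟩, rfl⟩
  exact ⟨(i, j), by simp [e, β]⟩

/-- The group is generated by products from two finitely generated groups: the part of `U_ℤ(ĝ₋)` in
a finite-dimensional degree space, and `U_ℤ`. -/
lemma fg_generatedPiece (hUZ : IsIntegralForm UZ) [FiniteDimensional ℂ g] [FiniteDimensional ℂ U] (n : ℤ) :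
    (generatedPiece A ℓ UZ n).FG := by
  let β : UniversalEnvelopingAlgebra ℂ (minusPart κ) →+ U →+ Verma κ ℓ U :=
    AddMonoidHom.mk' (fun a => AddMonoidHom.mk' (fun u => tensorToVerma κ ℓ U (a ⊗ₜ u))
      fun u u' => by rw [TensorProduct.tmul_add, map_add])
      fun a a' => by ext u; simp [TensorProduct.add_tmul]
  have hUfg : UZ.FG := by
    have := hUZ.fg_inf (F := ⊤) Module.Finite.fg_top
    rwa [show UZ ⊓ (⊤ : Submodule ℂ U).toAddSubgroup = UZ from inf_top_eq UZ] at this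
  refine fg_of_le (AddSubgroup.closure_mono ?_)
    (fg_closure_image2 β (A.minus_form.fg_inf (fg_envDegree_minusPart κ (-n))) hUfg)
  rintro _ ⟨a, ha, han, u, hu, rfl⟩
  exact ⟨a, ⟨ha, han⟩, u, hu, rfl⟩

end VermaStructure

/-! ### Passing from additive subgroups to linear spans -/

section SmulCore

variable {V : Type u} [AddCommGroup V] [Module ℂ V]

/-- The largest linear subspace contained in an additive subgroup. -/
def smulCore (C : AddSubgroup V) : Submodule ℂ V where
  carrier := {v | ∀ c : ℂ, c • v ∈ C}
  add_mem' h h' c := by rw [smul_add]; exact C.add_mem (h c) (h' c)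
  zero_mem' c := by rw [smul_zero]; exact C.zero_mem
  smul_mem' r v h c := by rw [smul_smul]; exact h _

lemma mem_of_mem_smulCore {C : AddSubgroup V} {v : V} (h : v ∈ smulCore C) : v ∈ C := by
  have := h 1
  rwa [one_smul] at this

lemma fg_map_addSubgroup {X Y : Type*} [AddCommGroup X] [AddCommGroup Y] {M : AddSubgroup X}
    (hM : M.FG) (f : X →+ Y) : (M.map f).FG := by
  classical
  obtain ⟨S, rfl⟩ := hM
  exact ⟨S.image f, by rw [Finset.coe_image, AddMonoidHom.map_closure]⟩

end SmulCore

/-! ### The maximal graded submodule and the irreducible quotient -/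

section MaximalSubmodule

attribute [local instance 100] LieRing.ofAssociativeRing

variable {g : Type u} [LieRing g] [LieAlgebra ℂ g] {κ : InvariantForm g}

section

variable (κ) (ℓ : ℤ) (U : Type v) [AddCommGroup U] [Module ℂ U] [LieRingModule g U]
  [LieModule ℂ g U]

/-- The sum of the spaces of nonzero weight in `V_ĝ(ℓ, U)`. -/
def offZero : Submodule ℂ (Verma κ ℓ U) := ⨆ n ≠ 0, vermaGrading κ ℓ U n

/-- The largest submodule of `V_ĝ(ℓ, U)` without component of weight `0`. -/
def residual : Submodule (Env κ) (Verma κ ℓ U) where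
  carrier := {v | ∀ y : Env κ, y • v ∈ offZero κ ℓ U}
  add_mem' h h' y := by rw [smul_add]; exact Submodule.add_mem _ (h y) (h' y)
  zero_mem' y := by rw [smul_zero]; exact Submodule.zero_mem _
  smul_mem' x v h y := by rw [← mul_smul]; exact h _

lemma residual_le_offZero : (residual κ ℓ U).restrictScalars ℂ ≤ offZero κ ℓ U := fun v hv => by
  have := hv 1
  rwa [one_smul] at this

lemma vermaTop_mem_vermaGrading (u : U) : vermaTop κ ℓ U u ∈ vermaGrading κ ℓ U 0 := by
  refine Submodule.subset_span ⟨1, ?_, u, by rw [map_one, one_smul]⟩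
  exact Submodule.subset_span ⟨[], by simp, by simp, by simp⟩

lemma exists_vermaTop_of_mem {v : Verma κ ℓ U} (hv : v ∈ vermaGrading κ ℓ U 0) :
    ∃ u, v = vermaTop κ ℓ U u := by
  have : vermaGrading κ ℓ U 0 ≤ LinearMap.range (vermaTop κ ℓ U) := by
    refine Submodule.span_le.2 ?_
    rintro _ ⟨x, hx, u, rfl⟩
    have hx' := envDegree_minusPart_le κ 0 (by simpa using hx)
    rw [minusBound] at hx'
    obtain ⟨c, rfl⟩ := Submodule.mem_span_singleton.1 hx'
    exact ⟨c • u, by rw [map_smul, map_smul, map_one, smul_assoc, one_smul]⟩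
  obtain ⟨u, hu⟩ := this hv
  exact ⟨u, hu.symm⟩

lemma vermaGrading_eq_bot {n : ℤ} (hn : n < 0) : vermaGrading κ ℓ U n = ⊥ := by
  rw [eq_bot_iff]
  refine Submodule.span_le.2 ?_
  rintro _ ⟨x, hx, u, rfl⟩
  rw [envDegree_minusPart_eq_bot κ (by omega), Submodule.mem_bot] at hx
  rw [hx, map_zero, zero_smul]
  exact Submodule.zero_mem _

lemma eq_zero_of_mem_offZero {v : Verma κ ℓ U} (h0 : v ∈ vermaGrading κ ℓ U 0)
    (h : v ∈ offZero κ ℓ U) : v = 0 :=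
  Submodule.disjoint_def.1 (iSupIndep_vermaGrading κ ℓ 0) v h0 h

lemma vermaScale_mem_offZero {v : Verma κ ℓ U} (hv : v ∈ offZero κ ℓ U) :
    vermaScale κ ℓ U v ∈ offZero κ ℓ U := by
  have : offZero κ ℓ U ≤ (offZero κ ℓ U).comap (vermaScale κ ℓ U) := by
    refine iSup₂_le fun n hn v hv => ?_
    rw [Submodule.mem_comap, Module.End.mem_eigenspace_iff.1 (vermaGrading_le_eigenspace κ ℓ n hv)]
    exact Submodule.smul_mem _ _ (Submodule.mem_iSup_of_mem n (Submodule.mem_iSup_of_mem hn hv))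
  exact this hv

lemma scaleEnv_surjective : Function.Surjective (scaleEnv κ) := by
  have : LinearMap.range (scaleEnv κ).toLinearMap = ⊤ := by
    rw [eq_top_iff, ← iSup_envEigen κ]
    refine iSup_le fun n x hx => ⟨(2 : ℂ) ^ (-n) • x, ?_⟩
    rw [map_smul, AlgHom.toLinearMap_apply, (mem_envEigen κ).1 hx, smul_smul,
      ← zpow_add₀ (two_ne_zero' ℂ), neg_add_cancel, zpow_zero, one_smul]
  exact LinearMap.range_eq_top.1 this

lemma vermaScale_mem_residual {v : Verma κ ℓ U} (hv : v ∈ residual κ ℓ U) :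
    vermaScale κ ℓ U v ∈ residual κ ℓ U := by
  intro y
  obtain ⟨y, rfl⟩ := scaleEnv_surjective κ y
  rw [← vermaScale_smul]
  exact vermaScale_mem_offZero κ ℓ U (hv y)

variable {U} in
-- A graded submodule meeting `1 ⊗ U` trivially has only components of nonzero weight. Conversely
-- `residual` is stable under `vermaScale`, hence graded, and so is itself a member of the family.
lemma vermaMaximal_eq_residual (htop : ⨆ n, vermaGrading κ ℓ U n = ⊤) :
    vermaMaximal κ ℓ U = residual κ ℓ U := by
  refine le_antisymm (sSup_le ?_) (le_sSup ⟨?_, fun u hu => ?_⟩)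
  · rintro N ⟨hgr, hN⟩ v hv y
    have h1 : y • v ∈ N.restrictScalars ℂ := N.smul_mem y hv
    rw [hgr] at h1
    refine (iSup_le fun n => ?_ : (⨆ n : ℤ, N.restrictScalars ℂ ⊓ vermaGrading κ ℓ U n) ≤
      offZero κ ℓ U) h1
    rcases eq_or_ne n 0 with rfl | hn
    · rintro w ⟨hw, hw0⟩
      obtain ⟨u, rfl⟩ := exists_vermaTop_of_mem κ ℓ U hw0
      rw [hN u hw]
      exact Submodule.zero_mem _
    · exact inf_le_right.trans (le_iSup₂_of_le n hn le_rfl)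
  · exact eq_iSup_inf_of_invariant (vermaGrading_le_eigenspace κ ℓ) htop
      fun v hv => vermaScale_mem_residual κ ℓ U hv
  · exact eq_zero_of_mem_offZero κ ℓ U (vermaTop_mem_vermaGrading κ ℓ U u)
      (residual_le_offZero κ ℓ U hu)

end

variable (A : IntegralEnvelope κ) (ℓ : ℤ) {U : Type v} [AddCommGroup U] [Module ℂ U]
  [LieRingModule g U] [LieModule ℂ g U] {UZ : AddSubgroup U}

lemma smul_mem_vermaGrading
    (hgr : ∀ n, vermaGrading κ ℓ U n = (vermaScale κ ℓ U).eigenspace ((2 : ℂ) ^ (-n)))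
    {j n : ℤ} {y : Env κ} (hy : y ∈ envEigen κ j) {v : Verma κ ℓ U}
    (hv : v ∈ vermaGrading κ ℓ U n) : y • v ∈ vermaGrading κ ℓ U (n - j) := by
  rw [hgr, Module.End.mem_eigenspace_iff] at hv ⊢
  rw [vermaScale_smul, hv, (mem_envEigen κ).1 hy, smul_assoc, smul_comm y, smul_smul,
    ← zpow_add₀ (two_ne_zero' ℂ)]
  congr 2
  ring

/-- If a submodule is not contained in `residual`, it contains a nonzero vector of weight `0`. -/
lemma exists_vermaTop_mem
    (hgr : ∀ n, vermaGrading κ ℓ U n = (vermaScale κ ℓ U).eigenspace ((2 : ℂ) ^ (-n)))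
    (htop : ⨆ n, vermaGrading κ ℓ U n = ⊤) {N : Submodule (Env κ) (Verma κ ℓ U)}
    (hN : residual κ ℓ U < N) : ∃ u : U, u ≠ 0 ∧ vermaTop κ ℓ U u ∈ N := by
  by_contra! hcon
  -- Since `N` need not be graded, its elements are handled by induction on a bound for their
  -- highest weight.
  let fil : ℤ → Submodule ℂ (Verma κ ℓ U) := fun k => ⨆ n, ⨆ (_ : n < k), vermaGrading κ ℓ U n
  have hfil0 : fil 0 = ⊥ := by
    simp only [fil, iSup_eq_bot]
    exact fun n hn => vermaGrading_eq_bot κ ℓ U hn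
  have hmono : Monotone fil := fun k k' hk =>
    iSup₂_le fun n hn => le_iSup₂_of_le n (lt_of_lt_of_le hn hk) le_rfl
  have key : ∀ k : ℕ, ∀ w ∈ N, w ∈ fil k → w ∈ residual κ ℓ U := by
    intro k
    induction k with
    | zero =>
      intro w _ hw
      rw [Nat.cast_zero, hfil0, Submodule.mem_bot] at hw
      rw [hw]
      exact Submodule.zero_mem _
    | succ k ih =>
      intro w hwN hw
      have hsplit : fil (k + 1 : ℕ) ≤ fil k ⊔ vermaGrading κ ℓ U k := by
        refine iSup₂_le fun n hn => ?_
        rcases eq_or_ne n k with rfl | hne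
        · exact le_sup_right
        · exact le_sup_of_le_left (le_iSup₂_of_le n (by push_cast at hn; omega) le_rfl)
      obtain ⟨w', hw', wk, hwk, rfl⟩ := Submodule.mem_sup.1 (hsplit hw)
      by_cases hres : wk ∈ residual κ ℓ U
      · refine Submodule.add_mem _ (ih w' ?_ hw') hres
        exact (N.add_mem_iff_left (hN.le hres)).1 hwN
      · exfalso
        -- A witness against `wk ∈ residual` can be taken homogeneous, since homogeneous elements
        -- span `U(ĝ)`.
        have : ∃ j, ∃ y ∈ envEigen κ j, y • wk ∉ offZero κ ℓ U := by
          by_contra! hc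
          apply hres
          intro y
          have hle : (⨆ j, envEigen κ j) ≤ (offZero κ ℓ U).comap (smulLin κ wk) :=
            iSup_le fun j y hy => hc j y hy
          rw [iSup_envEigen] at hle
          exact hle (Submodule.mem_top : y ∈ ⊤)
        obtain ⟨j, y, hy, hyw⟩ := this
        have h1 := smul_mem_vermaGrading ℓ hgr hy hwk
        -- Any other degree would send `wk` to a nonzero weight, inside `offZero`.
        obtain rfl : j = k := by
          by_contra hne
          exact hyw ((le_iSup₂_of_le (f := fun n (_ : n ≠ 0) => vermaGrading κ ℓ U n)
            ((k : ℤ) - j) (by omega) le_rfl) h1)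
        rw [sub_self] at h1
        -- Lowering by `k` takes weights below `k` to negative ones, so `y` sees only the leading
        -- component of the vector.
        have h2 : y • w' = 0 := by
          have hle : fil k ≤ LinearMap.ker (Module.toModuleEnd ℂ (S := Env κ) (Verma κ ℓ U) y) := by
            refine iSup₂_le fun n hn v hv => ?_
            have := smul_mem_vermaGrading ℓ hgr hy hv
            rw [vermaGrading_eq_bot κ ℓ U (by omega)] at this
            exact this
          exact hle hw'
        obtain ⟨u, hu⟩ := exists_vermaTop_of_mem κ ℓ U h1
        refine hcon u ?_ ?_
        · rintro rfl
          rw [map_zero] at hu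
          rw [hu] at hyw
          exact hyw (Submodule.zero_mem _)
        · rw [← hu, ← zero_add (y • wk), ← h2, ← smul_add]
          exact N.smul_mem y hwN
  refine hN.not_ge fun w hw => ?_
  have hex : ∃ k : ℕ, w ∈ fil k := by
    have hw' : w ∈ ⨆ n, vermaGrading κ ℓ U n := htop ▸ Submodule.mem_top
    clear hw
    induction hw' using Submodule.iSup_induction' with
    | mem n v hv =>
      refine ⟨(n + 1).toNat, ?_⟩
      exact (le_iSup₂_of_le (f := fun m (_ : m < ((n + 1).toNat : ℤ)) => vermaGrading κ ℓ U m)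
        n (by omega) le_rfl) hv
    | zero => exact ⟨0, Submodule.zero_mem _⟩
    | add v v' _ _ h h' =>
      obtain ⟨k, hk⟩ := h
      obtain ⟨k', hk'⟩ := h'
      exact ⟨max k k', Submodule.add_mem _ (hmono (by exact_mod_cast le_max_left k k') hk)
        (hmono (by exact_mod_cast le_max_right k k') hk')⟩
  obtain ⟨k, hk⟩ := hex
  exact key k w hw hk

/-- A submodule strictly above `residual` meets `1 ⊗ U` in a nonzero `g`-submodule, hence contains
all of `1 ⊗ U`, which generates. It is proper because `1 ⊗ U` is nonzero and meets it trivially. -/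
lemma isSimpleModule_irr
    (hgr : ∀ n, vermaGrading κ ℓ U n = (vermaScale κ ℓ U).eigenspace ((2 : ℂ) ^ (-n)))
    (htop : ⨆ n, vermaGrading κ ℓ U n = ⊤) (hU : LieModule.IsIrreducible ℂ g U) :
    IsSimpleModule (Env κ) (Irr κ ℓ U) := by
  rw [isSimpleModule_iff_isCoatom, vermaMaximal_eq_residual κ ℓ htop]
  have hlie : ∀ (x : g) (u : U), vermaTop κ ℓ U ⁅x, u⁆ =
      UniversalEnvelopingAlgebra.ι ℂ (mode κ 0 x) • vermaTop κ ℓ U u := fun x u => by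
    rw [ι_smul_vermaTop κ ℓ U ⟨mode κ 0 x, mode_mem_nonnegPart κ le_rfl x⟩ u]
    simp [nonnegAction]
  refine ⟨fun h => ?_, fun N hN => ?_⟩
  · have : Nontrivial U := LieModule.nontrivial_of_isIrreducible ℂ g U
    obtain ⟨u, hu⟩ := exists_ne (0 : U)
    have hmem : vermaTop κ ℓ U u ∈ residual κ ℓ U := h ▸ Submodule.mem_top
    have h0 := eq_zero_of_mem_offZero κ ℓ U (vermaTop_mem_vermaGrading κ ℓ U u)
      (residual_le_offZero κ ℓ U hmem)
    exact hu (vermaTop_injective κ ℓ U (h0.trans (map_zero _).symm))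
  · obtain ⟨u, hu, huN⟩ := exists_vermaTop_mem ℓ hgr htop hN
    let P : LieSubmodule ℂ g U :=
      { (N.restrictScalars ℂ).comap (vermaTop κ ℓ U) with
        lie_mem := fun {x u} hu => by
          change vermaTop κ ℓ U ⁅x, u⁆ ∈ N
          rw [hlie]
          exact N.smul_mem _ hu }
    have hP : P = ⊤ := by
      refine (eq_bot_or_eq_top P).resolve_left fun h => hu ?_
      have : u ∈ P := huN
      rw [h] at this
      exact (LieSubmodule.mem_bot u).1 this
    have hN' : N.restrictScalars ℂ = ⊤ :=
      submodule_eq_top_of_smul_vermaTop_mem ℓ _ fun x u => N.smul_mem x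
        (show u ∈ P from hP ▸ LieSubmodule.mem_top u)
    rw [eq_top_iff]
    intro v _
    exact (hN' ▸ Submodule.mem_top : v ∈ N.restrictScalars ℂ)

section

variable (κ) (U)

/-- The endomorphism of `L_ĝ(ℓ, U)` induced by `vermaScale`. -/
def irrScale (htop : ⨆ n, vermaGrading κ ℓ U n = ⊤) : Module.End ℂ (Irr κ ℓ U) :=
  linearOfSemilinear κ (ρ := scaleEnv κ) (Submodule.liftQ (vermaMaximal κ ℓ U)
    ((vermaMaximal κ ℓ U).mkQ.comp (vermaScaleₛₗ κ ℓ U)) fun v hv => by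
      rw [LinearMap.mem_ker, LinearMap.comp_apply, Submodule.mkQ_apply,
        Submodule.Quotient.mk_eq_zero]
      rw [vermaMaximal_eq_residual κ ℓ htop] at hv ⊢
      exact vermaScale_mem_residual κ ℓ U hv)

end

lemma iSupIndep_irrGrading (htop : ⨆ n, vermaGrading κ ℓ U n = ⊤) :
    iSupIndep (irrGrading κ ℓ U) := by
  refine (iSupIndep_eigenspace (irrScale κ ℓ U htop)).mono fun n => ?_
  refine Submodule.map_le_iff_le_comap.2 fun v hv => ?_
  rw [Submodule.mem_comap, Module.End.mem_eigenspace_iff]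
  change (vermaMaximal κ ℓ U).mkQ (vermaScale κ ℓ U v) = _
  rw [Module.End.mem_eigenspace_iff.1 (vermaGrading_le_eigenspace κ ℓ n hv)]
  rfl

/-- The projection from `V_ĝ(ℓ, U)` to `L_ĝ(ℓ, U)` as a `ℂ`-linear map. -/
abbrev irrProj (κ : InvariantForm g) (ℓ : ℤ) (U : Type v) [AddCommGroup U] [Module ℂ U]
    [LieRingModule g U] [LieModule ℂ g U] : Verma κ ℓ U →ₗ[ℂ] Irr κ ℓ U :=
  (vermaMaximal κ ℓ U).mkQ.restrictScalars ℂ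

lemma irrProj_surjective (κ : InvariantForm g) (ℓ : ℤ) (U : Type v) [AddCommGroup U] [Module ℂ U]
    [LieRingModule g U] [LieModule ℂ g U] : Function.Surjective (irrProj κ ℓ U) := by
  intro w
  obtain ⟨v, rfl⟩ := Submodule.Quotient.mk_surjective _ w
  exact ⟨v, rfl⟩

lemma generated_irr : generated A.whole (irrTop κ ℓ U '' UZ) =
    (generated A.whole (vermaTop κ ℓ U '' UZ)).map
      (irrProj κ ℓ U : Verma κ ℓ U →+ Irr κ ℓ U) := by
  rw [generated, generated, AddMonoidHom.map_closure]
  congr 1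
  ext w
  constructor
  · rintro ⟨x, hx, _, ⟨u, hu, rfl⟩, rfl⟩
    exact ⟨_, ⟨x, hx, _, ⟨u, hu, rfl⟩, rfl⟩, rfl⟩
  · rintro ⟨_, ⟨x, hx, _, ⟨u, hu, rfl⟩, rfl⟩, rfl⟩
    exact ⟨x, hx, _, ⟨u, hu, rfl⟩, rfl⟩

/-- The lift chosen on the Verma module preserves the maximal submodule, because that submodule is
defined by the action of `ĝ` and the weights, and the lift is compatible with both. -/
lemma hasScalarLifts_generated_irr (hUZ : IsIntegralForm UZ)
    (hinv : ∀ b ∈ A.zero, ∀ u ∈ UZ, zeroEnvAction κ ℓ U b u ∈ UZ) :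
    HasScalarLifts (generated A.whole (irrTop κ ℓ U '' UZ)) := by
  rw [generated_irr]
  refine HasScalarLifts.map (irrProj κ ℓ U) (irrProj_surjective κ ℓ U) fun f => ?_
  obtain ⟨F, hF⟩ := hasScalarLifts_generated A ℓ hUZ hinv f
  refine ⟨F, hF, fun v hv => ?_⟩
  set M := generated A.whole (vermaTop κ ℓ U '' UZ)
  have hoff : ∀ v ∈ offZero κ ℓ U, F v ∈ offZero κ ℓ U := by
    -- As `F` is only additive, a span argument needs the condition for all complex multiples at
    -- once; `smulCore` encodes this.
    have : offZero κ ℓ U ≤ smulCore ((offZero κ ℓ U).toAddSubgroup.comap F) := by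
      refine iSup₂_le fun n hn => ?_
      rw [← span_generatedPiece A ℓ hUZ hinv n]
      refine Submodule.span_le.2 fun m hm c => ?_
      change F (c • m) ∈ offZero κ ℓ U
      have hmM : m ∈ M := by
        rw [show M = _ from generated_eq_iSup A ℓ hinv]
        exact AddSubgroup.mem_iSup_of_mem n hm
      rw [hF c m hmM]
      exact Submodule.smul_mem _ _ (Submodule.mem_iSup_of_mem n
        (Submodule.mem_iSup_of_mem hn (generatedPiece_le A ℓ n hm)))
    exact fun v hv => mem_of_mem_smulCore (this hv)
  -- Both sides send `c • m` to `f c • y • m`, because `y • m` stays in `M`. This fails for general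
  -- `y`, so only integral elements are used.
  have hcomm : ∀ y ∈ A.whole, ∀ v, F (y • v) = y • F v := by
    intro y hy v
    have : Submodule.span ℂ (M : Set (Verma κ ℓ U)) ≤ smulCore (AddMonoidHom.eqLocus
        (F.comp (DistribSMul.toAddMonoidHom (Verma κ ℓ U) y))
        ((DistribSMul.toAddMonoidHom (Verma κ ℓ U) y).comp F)) := by
      refine Submodule.span_le.2 fun m hm c => ?_
      change F (y • c • m) = y • F (c • m)
      rw [smul_comm y c m, hF c _ (smul_mem_generated A.whole _ hy hm), hF c m hm, smul_comm]
    rw [span_generated A ℓ hUZ] at this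
    exact mem_of_mem_smulCore (this (Submodule.mem_top : v ∈ ⊤))
  change Submodule.Quotient.mk v = 0 at hv
  change Submodule.Quotient.mk (F v) = 0
  rw [Submodule.Quotient.mk_eq_zero,
    vermaMaximal_eq_residual κ ℓ (iSup_vermaGrading A ℓ hUZ hinv)] at hv ⊢
  intro y
  -- For fixed `F v` the condition is linear in `y`, so checking it on `U_ℤ(ĝ)`, which spans `U(ĝ)`,
  -- suffices.
  have hle : Submodule.span ℂ (A.whole : Set (Env κ)) ≤
      (offZero κ ℓ U).comap (smulLin κ (F v)) := by
    refine Submodule.span_le.2 fun y hy => ?_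
    change y • F v ∈ offZero κ ℓ U
    rw [← hcomm y hy]
    exact hoff _ (hv y)
  rw [A.span_whole] at hle
  exact hle (Submodule.mem_top : y ∈ ⊤)

end MaximalSubmodule

end AffineForms

end

/-! ### Assembly for the Verma module and its quotient -/

theorem theorem3p2 {g : Type u} [LieRing g] [LieAlgebra ℂ g] [FiniteDimensional ℂ g]
    (κ : AffineForms.InvariantForm g) (A : AffineForms.IntegralEnvelope κ)
    (U : Type v) [AddCommGroup U] [Module ℂ U] [FiniteDimensional ℂ U]
    [LieRingModule g U] [LieModule ℂ g U] (ℓ : ℤ)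
    (UZ : AddSubgroup U) (hUZ : AffineForms.IsIntegralForm UZ)
    (hinv : ∀ b ∈ A.zero, ∀ u ∈ UZ, AffineForms.zeroEnvAction κ ℓ U b u ∈ UZ) :
    (∀ WZ : AddSubgroup (AffineForms.Verma κ ℓ U),
      WZ = AffineForms.generated A.whole (AffineForms.vermaTop κ ℓ U '' UZ) →
        AffineForms.IsIntegralForm WZ ∧
        (∀ x ∈ A.whole, ∀ w ∈ WZ, x • w ∈ WZ) ∧
        AffineForms.IsCompatible WZ (AffineForms.vermaGrading κ ℓ U)) ∧
    (∀ WZ : AddSubgroup (AffineForms.Irr κ ℓ U),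
      WZ = AffineForms.generated A.whole (AffineForms.irrTop κ ℓ U '' UZ) →
        AffineForms.IsIntegralForm WZ ∧
        (∀ x ∈ A.whole, ∀ w ∈ WZ, x • w ∈ WZ) ∧
        AffineForms.IsCompatible WZ (AffineForms.irrGrading κ ℓ U)) ∧
    (LieModule.IsIrreducible ℂ g U →
      IsSimpleModule (AffineForms.Env κ) (AffineForms.Irr κ ℓ U)) := by
  have htop := AffineForms.iSup_vermaGrading A ℓ hUZ hinv
  refine ⟨?_, ?_, AffineForms.isSimpleModule_irr ℓ
    (AffineForms.vermaGrading_eq_eigenspace A ℓ hUZ hinv) htop⟩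
  · rintro _ rfl
    refine ⟨?_, fun x hx w hw => AffineForms.smul_mem_generated A.whole _ hx hw, ?_⟩
    · exact (AffineForms.hasScalarLifts_generated A ℓ hUZ hinv).isIntegralForm_of_iSup
        (AffineForms.iSupIndep_vermaGrading κ ℓ) htop
        (AffineForms.span_generatedPiece A ℓ hUZ hinv) (AffineForms.fg_generatedPiece A ℓ hUZ)
        (AffineForms.generated_eq_iSup A ℓ hinv)
    · exact AffineForms.isCompatible_of_iSup (AffineForms.iSupIndep_vermaGrading κ ℓ)
        (AffineForms.generatedPiece_le A ℓ) (AffineForms.generated_eq_iSup A ℓ hinv)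
  · rintro _ rfl
    have hmap : AffineForms.generated A.whole (AffineForms.irrTop κ ℓ U '' UZ) =
        ⨆ n, (AffineForms.generatedPiece A ℓ UZ n).map
          (AffineForms.irrProj κ ℓ U : AffineForms.Verma κ ℓ U →+ AffineForms.Irr κ ℓ U) := by
      rw [AffineForms.generated_irr, AffineForms.generated_eq_iSup A ℓ hinv, AddSubgroup.map_iSup]
    refine ⟨?_, fun x hx w hw => AffineForms.smul_mem_generated A.whole _ hx hw, ?_⟩
    · refine (AffineForms.hasScalarLifts_generated_irr A ℓ hUZ hinv).isIntegralForm_of_iSup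
        (AffineForms.iSupIndep_irrGrading ℓ htop) ?_ (fun n => ?_) (fun n => ?_) hmap
      · change ⨆ n, Submodule.map (AffineForms.irrProj κ ℓ U) _ = ⊤
        rw [← Submodule.map_iSup, htop, Submodule.map_top, LinearMap.range_eq_top]
        exact AffineForms.irrProj_surjective κ ℓ U
      · rw [AffineForms.irrGrading, ← AffineForms.span_generatedPiece A ℓ hUZ hinv n,
          Submodule.map_span]
        rfl
      · exact AffineForms.fg_map_addSubgroup (AffineForms.fg_generatedPiece A ℓ hUZ n) _
    · refine AffineForms.isCompatible_of_iSup (AffineForms.iSupIndep_irrGrading ℓ htop)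
        (fun n => ?_) hmap
      rintro _ ⟨w, hw, rfl⟩
      exact ⟨w, AffineForms.generatedPiece_le A ℓ n hw, rfl⟩
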